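/- For $k\in\mathbb R$ let $\langle k\rangle=(1+k^2)^{1/2}$. For $\sigma,b\in\mathbb R$ let $\|f\|_{H^\sigma}=\|\langle k\rangle^\sigma\widehat f(k)\|_{L^2_k}$ for functions on $\mathbb R$, and let $$\|u\|_{X^{\sigma,b}}=\big\|\langle \omega+k^2\rangle^{b}\langle k\rangle^{\sigma}\,\widehat u(\omega,k)\big\|_{L^2_{\omega,k}}$$ be the norm of the Bourgain space of the operator $i\partial_t+\partial_x^2$ on $\mathbb R_t\times\mathbb R_x$, where $\widehat u$ is the space-time Fourier transform. Let $s>\frac13$ and $a<\min(3s-1,\frac12)$. **(1) Quintilinear estimate.** There is $\delta_0=\delta_0(s,a)>0$ such that for all $0<\delta<\delta_0$ and all $\varepsilon>0$ there is a constant $C=C(s,a,\delta,\varepsilon)$ such that for every $u\in X^{s,\frac12+\varepsilon}$ (which lies in $L^2(\mathbb R^2)$) the function $|u|^4u$ is in $L^1(\mathbb R^2)$ and $$\big\||u|^4u\big\|_{X^{s+a,-\frac12+\delta}}\le C\,\|u\|_{X^{s,\frac12+\varepsilon}}^5 .$$ **(2) Nonlinear smoothing.** For all $\varepsilon>0$ and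 $T>0$ there is a constant $C=C(s,a,\varepsilon,T)$ such that the following holds for $\mu=\pm1$. Let $u_0\in H^s(\mathbb R)$, and let $u$ be a solution on $[0,T]$, in the sense of Duhamel's formula, of the quintic Schrödinger equation $$iu_t+u_{xx}=\mu|u|^4u,\qquad u(0)=u_0,$$ which agrees on $[0,T]$ with some $v\in X^{s,\frac12+\varepsilon}$. Then $u(t)-e^{it\partial_x^2}u_0$ belongs to $C([0,T];H^{s+a}(\mathbb R))$ and $$\sup_{0\le t\le T}\big\|u(t)-e^{it\partial_x^2}u_0\big\|_{H^{s+a}}\le C\,\|v\|_{X^{s,\frac12+\varepsilon}}^5 .$$ In particular, for $s\ge\frac12$ the nonlinear part of the solution gains any number $a<\frac12$ of derivatives. -/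

import Mathlib

open MeasureTheory Filter Topology FourierTransform
open scoped ENNReal NNReal SchwartzMap

noncomputable section

namespace QuinticNLS

/-- Space-time `ℝ_t × ℝ_x` with the Euclidean inner product; a point is `(t, x)`, and a point of
the dual space is `(τ, ξ)`. -/
abbrev SpaceTime : Type := WithLp 2 (ℝ × ℝ)

/-- The Japanese bracket `⟨y⟩ = (1 + y²)^{1/2}`. -/
def japaneseBracket (y : ℝ) : ℝ := Real.sqrt (1 + y ^ 2)

section Weighted

variable {E : Type*} [NormedAddCommGroup E] [InnerProductSpace ℝ E] [FiniteDimensional ℝ E]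
  [MeasurableSpace E] [BorelSpace E]

/-- The Fourier transform of the tempered distribution `S` is (given by) the function `f`. -/
def HasFourierTransform (S : 𝓢'(E, ℂ)) (f : E → ℂ) : Prop :=
  AEStronglyMeasurable f volume ∧
    ∀ φ : 𝓢(E, ℂ), Integrable (fun ζ => f ζ * φ ζ) volume ∧ (𝓕 S) φ = ∫ ζ, f ζ * φ ζ

/-- `‖w · Ŝ‖_{L²}`. It is `∞` if `Ŝ` is not a function; the function `Ŝ` is unique up to
null sets, so that the infimum is over a single value. -/
def weightedFourierNorm (w : E → ℝ) (S : 𝓢'(E, ℂ)) : ℝ≥0∞ :=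
  ⨅ (f : E → ℂ) (_ : HasFourierTransform S f), eLpNorm (fun ζ => (w ζ : ℂ) * f ζ) 2 volume

end Weighted

/-- The norm of `H^s(ℝ)`, `‖⟨k⟩^s f̂‖_{L²}`. Mathlib's Fourier transform has the kernel
`e^{-2πi x ξ}`, so that the angular frequency is `k = 2πξ`. -/
def sobolevNorm (s : ℝ) (S : 𝓢'(ℝ, ℂ)) : ℝ≥0∞ :=
  weightedFourierNorm (fun ξ => japaneseBracket (2 * Real.pi * ξ) ^ s) S

/-- The norm of the Bourgain space `X^{s,b}` of the operator `i∂_t + ∂_x²`, which is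
`‖⟨ω + k²⟩^b ⟨k⟩^s û‖_{L²}` with the angular frequencies `ω = 2πτ` and `k = 2πξ`. -/
def bourgainNorm (s b : ℝ) (S : 𝓢'(SpaceTime, ℂ)) : ℝ≥0∞ :=
  weightedFourierNorm
    (fun ζ => japaneseBracket (2 * Real.pi * ζ.fst + (2 * Real.pi * ζ.snd) ^ 2) ^ b *
      japaneseBracket (2 * Real.pi * ζ.snd) ^ s) S

/-- The quintic nonlinearity `|z|⁴ z`. -/
def quintic (z : ℂ) : ℂ := (‖z‖ : ℂ) ^ 4 * z

/-- The symbol `e^{-itk²}`, `k = 2πξ`, of the free propagator `e^{it∂_x²}`. -/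
def freeSymbol (t ξ : ℝ) : ℂ :=
  Complex.exp (((-(t * (2 * Real.pi * ξ) ^ 2) : ℝ) : ℂ) * Complex.I)

theorem memLp_freeSymbol_mul (t : ℝ) (g : Lp ℂ 2 (volume : Measure ℝ)) :
    MemLp (fun ξ => freeSymbol t ξ * g ξ) 2 volume := by
  refine (Lp.memLp g).of_le ?_ (Eventually.of_forall fun ξ => ?_)
  · refine AEStronglyMeasurable.mul ?_ (Lp.aestronglyMeasurable g)
    refine Continuous.aestronglyMeasurable ?_
    unfold freeSymbol
    fun_prop
  · rw [norm_mul, freeSymbol, Complex.norm_exp_ofReal_mul_I, one_mul]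

/-- The free evolution `e^{it∂_x²} f` of `f ∈ L²(ℝ)`. -/
def freeEvolution (t : ℝ) (f : Lp ℂ 2 (volume : Measure ℝ)) : Lp ℂ 2 (volume : Measure ℝ) :=
  𝓕⁻ ((memLp_freeSymbol_mul t (𝓕 f)).toLp _)

/-- The curve `u` in `L²(ℝ)` solves `i u_t + u_xx = μ |u|⁴ u`, `u(0) = u₀`, on `[0, T]`, in the sense
of Duhamel's formula
`u(t) = e^{it∂_x²} u₀ - i μ ∫₀ᵗ e^{i(t-t')∂_x²} (|u|⁴u)(t') dt'`,
which is read on the Fourier side; the nonlinearity is in `L¹(ℝ)` at almost every time, and the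
integral in `t'` converges absolutely. -/
structure IsMildSolution (μ T : ℝ) (u₀ : Lp ℂ 2 (volume : Measure ℝ))
    (u : ℝ → Lp ℂ 2 (volume : Measure ℝ)) : Prop where
  integrable : ∀ᵐ t, t ∈ Set.Icc 0 T → Integrable (fun x => quintic (u t x)) volume
  intervalIntegrable : ∀ t ∈ Set.Icc 0 T, ∀ᵐ ξ, IntervalIntegrable
    (fun t' => freeSymbol (t - t') ξ * (𝓕 (fun x => quintic (u t' x)) : ℝ → ℂ) ξ) volume 0 t
  duhamel : ∀ t ∈ Set.Icc 0 T, ∀ᵐ ξ,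
    (𝓕 (u t) : Lp ℂ 2 (volume : Measure ℝ)) ξ =
      freeSymbol t ξ * (𝓕 u₀ : Lp ℂ 2 (volume : Measure ℝ)) ξ -
        Complex.I * (μ : ℂ) *
          ∫ t' in (0 : ℝ)..t, freeSymbol (t - t') ξ * (𝓕 (fun x => quintic (u t' x)) : ℝ → ℂ) ξ

/-- The curve `u` agrees on `[0, T]` with the function `v` on space-time. -/
def AgreesOn (T : ℝ) (u : ℝ → Lp ℂ 2 (volume : Measure ℝ))
    (v : Lp ℂ 2 (volume : Measure SpaceTime)) : Prop :=
  ∀ᵐ t, t ∈ Set.Icc 0 T → ∀ᵐ x, u t x = v (WithLp.toLp 2 (t, x))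

end QuinticNLS

end

/-!
Write `û = ⟨k⟩^{-s} ⟨ω + k²⟩^{-1/2-ε} φ` with `φ ∈ L²`. By duality the quintilinear estimate becomes
a bound for a form in five such functions and a dual function `w ∈ L²`, in which all Fourier
transforms may be replaced by their absolute values. Order the five input frequencies by size. If
the smallest of them is comparable to the output frequency `k_out`, then the weights `⟨k_i⟩^{-s}`
absorb `⟨k_out⟩^{s+a}`; otherwise the largest input frequency absorbs only `⟨k_out⟩^s`. In both
cases enough decay remains for a factor `⟨k⟩^{-3s/2}` at each of two intermediate frequencies, and
as `3s/2 > 1/2` these two functions have integrable Fourier transforms. Two more functions are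
paired by the bilinear `L²` Strichartz estimate. The last one, which has the smallest frequency, is
paired with `w`: the two paraboloids are transversal there with slope of order `⟨k_out⟩`, and this
pays for `⟨k_out⟩^a` with `a < 1/2`.

For the smoothing, pass to the interaction picture `e^{itk²} F̂(t)`, `F = |v|⁴v`, whose Fourier
transform in time is that of `F` as a function of the modulation `ω + k²`. A primitive in time is
bounded by `∫ ⟨ω⟩⁻¹ |·| dω`, uniformly on bounded time intervals, and since `⟨ω⟩^{-1/2-δ}` is square
integrable, this is controlled by the norm of `X^{s+a,-1/2+δ}`. Continuity in time follows by
dominated convergence.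
-/

noncomputable section

namespace QuinticNLS

section FourierTransform

variable {E : Type*} [NormedAddCommGroup E] [InnerProductSpace ℝ E] [FiniteDimensional ℝ E]
  [MeasurableSpace E] [BorelSpace E]

theorem locallyIntegrable_of_integrable_mul_schwartz {μ : Measure E} {f : E → ℂ}
    (hf : ∀ φ : 𝓢(E, ℂ), Integrable (fun x => f x * φ x) μ) : LocallyIntegrable f μ := by
  rw [locallyIntegrable_iff]
  intro K hK
  obtain ⟨R, hR, hKR⟩ : ∃ R : ℝ, 0 < R ∧ K ⊆ Metric.closedBall 0 R := by
    obtain ⟨R, hR⟩ := hK.isBounded.subset_closedBall 0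
    exact ⟨max R 1, by positivity, hR.trans (Metric.closedBall_subset_closedBall (le_max_left _ _))⟩
  let χ : ContDiffBump (0 : E) := ⟨R, R + 1, hR, by linarith⟩
  have hχc : HasCompactSupport (Complex.ofRealCLM ∘ χ) := χ.hasCompactSupport.comp_left rfl
  have hχs : ContDiff ℝ (⊤ : ℕ∞) (Complex.ofRealCLM ∘ χ) :=
    Complex.ofRealCLM.contDiff.comp χ.contDiff
  refine ((hf (hχc.toSchwartzMap hχs)).integrableOn (s := K)).congr_fun (fun x hx => ?_)
    hK.measurableSet
  simp [χ.one_of_mem_closedBall (hKR hx)]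

theorem ae_eq_of_integral_mul_schwartz_eq {μ : Measure E} {f g : E → ℂ}
    (hf : ∀ φ : 𝓢(E, ℂ), Integrable (fun x => f x * φ x) μ)
    (hg : ∀ φ : 𝓢(E, ℂ), Integrable (fun x => g x * φ x) μ)
    (hfg : ∀ φ : 𝓢(E, ℂ), ∫ x, f x * φ x ∂μ = ∫ x, g x * φ x ∂μ) : f =ᵐ[μ] g := by
  refine ae_eq_of_integral_contDiff_smul_eq (locallyIntegrable_of_integrable_mul_schwartz hf)
    (locallyIntegrable_of_integrable_mul_schwartz hg) fun ψ hψ hψc => ?_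
  have hc : HasCompactSupport (Complex.ofRealCLM ∘ ψ) := hψc.comp_left rfl
  have hs : ContDiff ℝ (⊤ : ℕ∞) (Complex.ofRealCLM ∘ ψ) := Complex.ofRealCLM.contDiff.comp hψ
  simpa [mul_comm] using hfg (hc.toSchwartzMap hs)

omit [FiniteDimensional ℝ E] in
theorem integrable_mul_schwartz_of_memLp_two {μ : Measure E} [μ.HasTemperateGrowth] {f : E → ℂ}
    (hf : MemLp f 2 μ) (φ : 𝓢(E, ℂ)) : Integrable (fun x => f x * φ x) μ :=
  hf.integrable_mul (φ.memLp 2 μ)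

omit [FiniteDimensional ℝ E] in
theorem integrable_mul_schwartz_of_integrable {μ : Measure E} {f : E → ℂ} (hf : Integrable f μ)
    (φ : 𝓢(E, ℂ)) : Integrable (fun x => f x * φ x) μ :=
  hf.mul_bdd (c := SchwartzMap.seminorm ℝ 0 0 φ) φ.continuous.aestronglyMeasurable
    (Eventually.of_forall fun x => φ.norm_le_seminorm ℝ x)

theorem HasFourierTransform.ae_eq {S : 𝓢'(E, ℂ)} {f g : E → ℂ} (hf : HasFourierTransform S f)
    (hg : HasFourierTransform S g) : f =ᵐ[volume] g :=
  ae_eq_of_integral_mul_schwartz_eq (fun φ => (hf.2 φ).1) (fun φ => (hg.2 φ).1)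
    fun φ => (hf.2 φ).2.symm.trans (hg.2 φ).2

theorem hasFourierTransform_Lp_two (u : Lp ℂ 2 (volume : Measure E)) :
    HasFourierTransform (u : 𝓢'(E, ℂ)) (𝓕 u : Lp ℂ 2 (volume : Measure E)) := by
  refine ⟨Lp.aestronglyMeasurable _, fun φ =>
    ⟨integrable_mul_schwartz_of_memLp_two (Lp.memLp _) φ, ?_⟩⟩
  rw [Lp.fourier_toTemperedDistribution_eq, Lp.toTemperedDistribution_apply]
  simp [mul_comm]

theorem integral_fourier_Lp_two_mul_schwartz (u : Lp ℂ 2 (volume : Measure E)) (φ : 𝓢(E, ℂ)) :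
    ∫ x, (𝓕 u : Lp ℂ 2 (volume : Measure E)) x * φ x = ∫ x, u x * 𝓕 φ x := by
  rw [← ((hasFourierTransform_Lp_two u).2 φ).2, TemperedDistribution.fourier_apply,
    Lp.toTemperedDistribution_apply]
  simp [mul_comm]

theorem integral_fourier_mul_schwartz {F : E → ℂ} (hF : Integrable F volume) (φ : 𝓢(E, ℂ)) :
    ∫ x, 𝓕 F x * φ x = ∫ x, F x * 𝓕 φ x := by
  simpa using! VectorFourier.integral_bilin_fourierIntegral_eq_flip (ContinuousLinearMap.mul ℂ ℂ)
    (L := innerₗ E) Real.continuous_fourierChar continuous_inner hF φ.integrable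

theorem continuous_fourier_of_integrable {G : Type*} [NormedAddCommGroup G] [NormedSpace ℂ G]
    {F : E → G} (hF : Integrable F volume) : Continuous (𝓕 F) :=
  VectorFourier.fourierIntegral_continuous Real.continuous_fourierChar
    (innerSL ℝ).continuous₂ hF

theorem hasFourierTransform_toLp_one {F : E → ℂ} (hF : MemLp F 1 volume) :
    HasFourierTransform (hF.toLp F : 𝓢'(E, ℂ)) (𝓕 F) := by
  have hFi := memLp_one_iff_integrable.1 hF
  have hcont := continuous_fourier_of_integrable hFi
  refine ⟨hcont.aestronglyMeasurable, fun φ => ⟨?_, ?_⟩⟩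
  · exact φ.integrable.bdd_mul (c := ∫ x, ‖F x‖) hcont.aestronglyMeasurable
      (Eventually.of_forall (VectorFourier.norm_fourierIntegral_le_integral_norm _ _ _ F))
  · rw [TemperedDistribution.fourier_apply, Lp.toTemperedDistribution_apply,
      integral_fourier_mul_schwartz hFi]
    refine integral_congr_ae ?_
    filter_upwards [hF.coeFn_toLp] with x hx
    rw [hx, smul_eq_mul, mul_comm]

theorem weightedFourierNorm_Lp_two (w : E → ℝ) (u : Lp ℂ 2 (volume : Measure E)) :
    weightedFourierNorm w (u : 𝓢'(E, ℂ)) =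
      eLpNorm (fun ζ => (w ζ : ℂ) * (𝓕 u : Lp ℂ 2 (volume : Measure E)) ζ) 2 volume := by
  refine le_antisymm (iInf₂_le _ (hasFourierTransform_Lp_two u)) (le_iInf₂ fun f hf => ?_)
  refine le_of_eq (eLpNorm_congr_ae ?_)
  filter_upwards [(hasFourierTransform_Lp_two u).ae_eq hf] with ζ hζ
  rw [hζ]

theorem weightedFourierNorm_toLp_one_le (w : E → ℝ) {F : E → ℂ} (hF : MemLp F 1 volume) :
    weightedFourierNorm w (hF.toLp F : 𝓢'(E, ℂ)) ≤
      eLpNorm (fun ζ => (w ζ : ℂ) * 𝓕 F ζ) 2 volume :=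
  iInf₂_le _ (hasFourierTransform_toLp_one hF)

theorem fourier_Lp_two_ae_eq_of_forall_schwartz {u : Lp ℂ 2 (volume : Measure E)} {g : E → ℂ}
    (hg : MemLp g 2 volume) (h : ∀ φ : 𝓢(E, ℂ), ∫ x, g x * φ x = ∫ x, u x * 𝓕 φ x) :
    (𝓕 u : Lp ℂ 2 (volume : Measure E)) =ᵐ[volume] g :=
  ae_eq_of_integral_mul_schwartz_eq
    (integrable_mul_schwartz_of_memLp_two (Lp.memLp _))
    (integrable_mul_schwartz_of_memLp_two hg)
    fun φ => (integral_fourier_Lp_two_mul_schwartz u φ).trans (h φ).symm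

theorem exists_memLp_two_of_memLp_two_fourier {F : E → ℂ} (hF : Integrable F volume)
    (hF' : MemLp (𝓕 F) 2 volume) :
    ∃ h : MemLp F 2 volume, (𝓕 (h.toLp F) : Lp ℂ 2 (volume : Measure E)) =ᵐ[volume] 𝓕 F := by
  set H : Lp ℂ 2 (volume : Measure E) := 𝓕⁻ (hF'.toLp (𝓕 F))
  have hFH : 𝓕 H = hF'.toLp (𝓕 F) := fourier_fourierInv_eq _
  have hHF : H =ᵐ[volume] F := by
    refine ae_eq_of_integral_mul_schwartz_eq
      (integrable_mul_schwartz_of_memLp_two (Lp.memLp _))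
      (integrable_mul_schwartz_of_integrable hF) fun φ => ?_
    obtain ⟨ψ, rfl⟩ : ∃ ψ : 𝓢(E, ℂ), 𝓕 ψ = φ := ⟨𝓕⁻ φ, fourier_fourierInv_eq _⟩
    rw [← integral_fourier_Lp_two_mul_schwartz, ← integral_fourier_mul_schwartz hF, hFH]
    refine integral_congr_ae ?_
    filter_upwards [hF'.coeFn_toLp] with x hx
    rw [hx]
  have hF₂ : MemLp F 2 volume := (memLp_congr_ae hHF).1 (Lp.memLp H)
  have htoLp : hF₂.toLp F = H := Lp.ext (hF₂.coeFn_toLp.trans hHF.symm)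
  exact ⟨hF₂, by rw [htoLp, hFH]; exact hF'.coeFn_toLp⟩

end FourierTransform

section FourierProduct

variable {E : Type*} [NormedAddCommGroup E] [InnerProductSpace ℝ E] [FiniteDimensional ℝ E]
  [MeasurableSpace E] [BorelSpace E]

theorem memLp_comp_add_right {p : ℝ≥0∞} {f : E → ℂ} (hf : MemLp f p volume) (ζ : E) :
    MemLp (fun η => f (η + ζ)) p volume :=
  hf.comp_measurePreserving (measurePreserving_add_right volume ζ)

theorem memLp_comp_neg {p : ℝ≥0∞} {f : E → ℂ} (hf : MemLp f p volume) :
    MemLp (fun η => f (-η)) p volume :=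
  hf.comp_measurePreserving (Measure.measurePreserving_neg volume)

/-- The involution `φ ↦ conj (φ (-·))` of the Schwartz space, which the Fourier transform turns
into complex conjugation. -/
def schwartzConjNeg (φ : 𝓢(E, ℂ)) : 𝓢(E, ℂ) :=
  SchwartzMap.postcompCLM (𝕜 := ℝ) (Complex.conjCLE : ℂ →L[ℝ] ℂ)
    (SchwartzMap.compCLMOfContinuousLinearEquiv ℝ (ContinuousLinearEquiv.neg ℝ (M := E)) φ)

omit [FiniteDimensional ℝ E] [MeasurableSpace E] [BorelSpace E] in
theorem schwartzConjNeg_apply (φ : 𝓢(E, ℂ)) (x : E) :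
    schwartzConjNeg φ x = (starRingEnd ℂ) (φ (-x)) := by
  simp [schwartzConjNeg]

theorem fourier_schwartzConjNeg (φ : 𝓢(E, ℂ)) (x : E) :
    𝓕 (schwartzConjNeg φ) x = (starRingEnd ℂ) (𝓕 φ x) := by
  rw [SchwartzMap.fourier_coe, SchwartzMap.fourier_coe, Real.fourier_eq, Real.fourier_eq,
    ← integral_conj, ← integral_neg_eq_self]
  simp [schwartzConjNeg_apply, Circle.smul_def, ← Circle.coe_inv_eq_conj, AddChar.map_neg_eq_inv]

theorem fourier_compSubConst (φ : 𝓢(E, ℂ)) (ζ x : E) :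
    𝓕 (φ.compSubConstCLM ℝ ζ) x = Real.fourierChar (-inner ℝ ζ x) • 𝓕 φ x := by
  have hφ : ⇑(φ.compSubConstCLM ℝ ζ) = φ ∘ fun v => v + -ζ := by
    ext v
    simp [sub_eq_add_neg]
  rw [SchwartzMap.fourier_coe, SchwartzMap.fourier_coe, hφ]
  refine (congrFun (VectorFourier.fourierIntegral_comp_add_right Real.fourierChar volume
    (innerₗ E) φ (-ζ)) x).trans ?_
  rw [map_neg, LinearMap.neg_apply, innerₗ_apply_apply]
  rfl

theorem fourier_star_Lp_two (u : Lp ℂ 2 (volume : Measure E)) :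
    (𝓕 (star u) : Lp ℂ 2 (volume : Measure E)) =ᵐ[volume]
      fun η => (starRingEnd ℂ) ((𝓕 u : Lp ℂ 2 (volume : Measure E)) (-η)) := by
  refine fourier_Lp_two_ae_eq_of_forall_schwartz (memLp_comp_neg (Lp.memLp _).star) fun φ => ?_
  have h := congrArg (starRingEnd ℂ) (integral_fourier_Lp_two_mul_schwartz u (schwartzConjNeg φ))
  simp only [← integral_conj, map_mul, fourier_schwartzConjNeg, schwartzConjNeg_apply,
    Complex.conj_conj] at h
  rw [← integral_neg_eq_self] at h
  simp only [neg_neg] at h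
  rw [h]
  refine integral_congr_ae ?_
  filter_upwards [Lp.coeFn_star u] with x hx
  rw [hx, Pi.star_apply, starRingEnd_apply]

theorem memLp_fourierChar_smul {p : ℝ≥0∞} {f : E → ℂ} (hf : MemLp f p volume) (ζ : E) :
    MemLp (fun x => Real.fourierChar (-inner ℝ ζ x) • f x) p volume := by
  refine hf.of_le ?_ (Eventually.of_forall fun x => by rw [Circle.norm_smul])
  refine AEStronglyMeasurable.smul (Continuous.aestronglyMeasurable ?_) hf.1
  have hinner : Continuous fun x : E => -inner ℝ ζ x := by fun_prop
  exact continuous_subtype_val.comp (Real.continuous_fourierChar.comp hinner)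

theorem fourier_fourierChar_smul_Lp_two (u : Lp ℂ 2 (volume : Measure E)) (ζ : E) :
    (𝓕 ((memLp_fourierChar_smul (Lp.memLp u) ζ).toLp _) : Lp ℂ 2 (volume : Measure E)) =ᵐ[volume]
      fun η => (𝓕 u : Lp ℂ 2 (volume : Measure E)) (η + ζ) := by
  refine fourier_Lp_two_ae_eq_of_forall_schwartz (memLp_comp_add_right (Lp.memLp _) ζ) fun φ => ?_
  have h := integral_fourier_Lp_two_mul_schwartz u (φ.compSubConstCLM ℝ ζ)
  rw [← integral_add_right_eq_self _ ζ] at h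
  simp only [SchwartzMap.compSubConstCLM_apply, add_sub_cancel_right, fourier_compSubConst] at h
  rw [h]
  refine integral_congr_ae ?_
  filter_upwards [(memLp_fourierChar_smul (Lp.memLp u) ζ).coeFn_toLp] with x hx
  rw [hx, smul_mul_assoc, mul_smul_comm]

/-- Parseval's identity for `conj p` and the modulation of `q` by `ζ`. -/
theorem fourier_mul_Lp_two (p q : Lp ℂ 2 (volume : Measure E)) (ζ : E) :
    𝓕 (fun x => p x * q x) ζ =
      ∫ η, (𝓕 p : Lp ℂ 2 (volume : Measure E)) η *
        (𝓕 q : Lp ℂ 2 (volume : Measure E)) (ζ - η) := by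
  set q' : Lp ℂ 2 (volume : Measure E) := (memLp_fourierChar_smul (Lp.memLp q) ζ).toLp _
  have hparseval := Lp.inner_fourier_eq (star p) q'
  rw [L2.inner_def, L2.inner_def] at hparseval
  have hphysical : ∫ x, inner ℂ ((star p : Lp ℂ 2 (volume : Measure E)) x) (q' x) =
      𝓕 (fun x => p x * q x) ζ := by
    rw [Real.fourier_eq]
    refine integral_congr_ae ?_
    filter_upwards [Lp.coeFn_star p, (memLp_fourierChar_smul (Lp.memLp q) ζ).coeFn_toLp]
      with x hp hq
    rw [hp, hq, RCLike.inner_apply, Pi.star_apply, starRingEnd_apply, star_star,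
      real_inner_comm, smul_mul_assoc, mul_comm (q x)]
  rw [← hphysical, ← hparseval, ← integral_neg_eq_self]
  have hneg := (Measure.measurePreserving_neg (volume : Measure E)).quasiMeasurePreserving
  refine integral_congr_ae ?_
  filter_upwards [hneg.ae_eq_comp (fourier_star_Lp_two p),
    hneg.ae_eq_comp (fourier_fourierChar_smul_Lp_two q ζ)] with η hp hq
  simp only [Function.comp_apply] at hp hq
  rw [hp, hq, RCLike.inner_apply, Complex.conj_conj, neg_neg, mul_comm, neg_add_eq_sub]

end FourierProduct

section Lintegral

variable {α : Type*} [MeasurableSpace α] {μ : Measure α}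

theorem eLpNorm_two_sq {F : Type*} [NormedAddCommGroup F] (f : α → F) :
    eLpNorm f 2 μ ^ 2 = ∫⁻ x, ‖f x‖ₑ ^ 2 ∂μ := by
  simpa using eLpNorm_nnreal_pow_eq_lintegral (μ := μ) (f := f) (p := 2) two_ne_zero

theorem add_sq_le_two_mul_add_sq (x y : ℝ≥0∞) : (x + y) ^ 2 ≤ 2 * (x ^ 2 + y ^ 2) := by
  have h := ENNReal.rpow_add_le_mul_rpow_add_rpow x y (p := 2) (by norm_num)
  norm_num at h
  exact h

theorem lintegral_sq_add_lt_top {f g : α → ℝ≥0∞} (hf : Measurable f)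
    (hf₂ : ∫⁻ x, f x ^ 2 ∂μ < ∞) (hg₂ : ∫⁻ x, g x ^ 2 ∂μ < ∞) : ∫⁻ x, (f x + g x) ^ 2 ∂μ < ∞ := by
  calc ∫⁻ x, (f x + g x) ^ 2 ∂μ ≤ ∫⁻ x, 2 * (f x ^ 2 + g x ^ 2) ∂μ :=
        lintegral_mono fun x => add_sq_le_two_mul_add_sq _ _
    _ = 2 * ((∫⁻ x, f x ^ 2 ∂μ) + ∫⁻ x, g x ^ 2 ∂μ) := by
        rw [lintegral_const_mul' _ _ (by simp), lintegral_add_left (by fun_prop)]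
    _ < ∞ := ENNReal.mul_lt_top (by simp) (ENNReal.add_lt_top.2 ⟨hf₂, hg₂⟩)

theorem rpow_half_sq (y : ℝ≥0∞) : (y ^ (1 / 2 : ℝ)) ^ 2 = y := by
  rw [← ENNReal.rpow_natCast, ← ENNReal.rpow_mul]
  norm_num

theorem le_rpow_half_of_sq_le {x y : ℝ≥0∞} (h : x ^ 2 ≤ y) : x ≤ y ^ (1 / 2 : ℝ) := by
  rwa [← ENNReal.pow_le_pow_left_iff two_ne_zero, rpow_half_sq]

theorem sq_lintegral_mul_le {f g : α → ℝ≥0∞} (hf : AEMeasurable f μ) (hg : AEMeasurable g μ) :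
    (∫⁻ x, f x * g x ∂μ) ^ 2 ≤ (∫⁻ x, f x ^ 2 ∂μ) * ∫⁻ x, g x ^ 2 ∂μ := by
  have h := ENNReal.lintegral_mul_le_Lp_mul_Lq μ Real.HolderConjugate.two_two hf hg
  simp only [Pi.mul_apply, ENNReal.rpow_ofNat] at h
  calc (∫⁻ x, f x * g x ∂μ) ^ 2
      ≤ ((∫⁻ x, f x ^ 2 ∂μ) ^ (1 / 2 : ℝ) * (∫⁻ x, g x ^ 2 ∂μ) ^ (1 / 2 : ℝ)) ^ 2 := by gcongr
    _ = _ := by rw [mul_pow, rpow_half_sq, rpow_half_sq]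

/-- Duality is tested on square roots of simple functions below `h ^ 2` of finite integral. -/
theorem lintegral_sq_le_of_forall_sq_lintegral_mul_le [SigmaFinite μ] {h : α → ℝ≥0∞} {C : ℝ≥0∞}
    (H : ∀ φ : α → ℝ≥0∞, Measurable φ → (∫⁻ x, φ x * h x ∂μ) ^ 2 ≤ C * ∫⁻ x, φ x ^ 2 ∂μ) :
    ∫⁻ x, h x ^ 2 ∂μ ≤ C := by
  refine le_of_forall_lt fun L hL => ?_
  obtain ⟨f, hfh, hLf⟩ : ∃ f : SimpleFunc α ℝ≥0, (∀ x, (f x : ℝ≥0∞) ≤ h x ^ 2) ∧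
      L < ∫⁻ x, f x ∂μ := by
    simp only [lintegral_eq_nnreal (fun x => h x ^ 2), lt_iSup_iff] at hL
    obtain ⟨f, hf, hLf⟩ := hL
    exact ⟨f, hf, by rwa [← SimpleFunc.lintegral_eq_lintegral] at hLf⟩
  obtain ⟨g, hgf, hg, hLg⟩ := SimpleFunc.exists_lt_lintegral_simpleFunc_of_lt_lintegral hLf
  set φ : α → ℝ≥0∞ := fun x => (g x : ℝ≥0∞) ^ (1 / 2 : ℝ)
  have hφm : Measurable φ := g.measurable.coe_nnreal_ennreal.pow_const _
  have hφh : ∀ x, φ x ≤ h x := fun x => by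
    rw [← ENNReal.pow_le_pow_left_iff two_ne_zero, rpow_half_sq]
    exact (ENNReal.coe_le_coe.2 (hgf x)).trans (hfh x)
  have hφ : ∫⁻ x, φ x ^ 2 ∂μ = ∫⁻ x, g x ∂μ := lintegral_congr fun x => rpow_half_sq _
  refine hLg.trans_le ((ENNReal.mul_le_mul_iff_left (bot_lt_of_lt hLg).ne' hg.ne).1 ?_)
  calc (∫⁻ x, g x ∂μ) * ∫⁻ x, g x ∂μ = (∫⁻ x, φ x * φ x ∂μ) ^ 2 := by simp only [← sq, hφ]
    _ ≤ (∫⁻ x, φ x * h x ∂μ) ^ 2 := by gcongr with x; exact hφh x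
    _ ≤ C * ∫⁻ x, g x ∂μ := hφ ▸ H φ hφm

end Lintegral

section Convolution

variable {G : Type*} [AddCommGroup G] [MeasurableSpace G] [MeasurableAdd₂ G] [MeasurableNeg G]
  {μ : Measure G} [SFinite μ] [μ.IsAddLeftInvariant] {f g : G → ℝ≥0∞}

omit [MeasurableNeg G] in
theorem lintegral_sq_kernel_le {κ : G → G → ℝ≥0∞} {C : ℝ≥0∞}
    (hκ : Measurable (Function.uncurry κ)) (hf : Measurable f) (hg : Measurable g)
    (hC : ∀ y, ∫⁻ x, κ y x ^ 2 ∂μ ≤ C) :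
    ∫⁻ y, (∫⁻ x, κ y x * (f (y + x) * g x) ∂μ) ^ 2 ∂μ ≤
      C * (∫⁻ x, f x ^ 2 ∂μ) * ∫⁻ x, g x ^ 2 ∂μ := by
  calc ∫⁻ y, (∫⁻ x, κ y x * (f (y + x) * g x) ∂μ) ^ 2 ∂μ
      ≤ ∫⁻ y, C * ∫⁻ x, (f (y + x) * g x) ^ 2 ∂μ ∂μ := by
        refine lintegral_mono fun y => ?_
        refine (sq_lintegral_mul_le hκ.of_uncurry_left.aemeasurable (by fun_prop)).trans ?_
        gcongr
        exact hC y
    _ = C * ∫⁻ y, ∫⁻ x, (f (y + x) * g x) ^ 2 ∂μ ∂μ := lintegral_const_mul _ (by fun_prop)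
    _ = C * ∫⁻ x, ∫⁻ y, f (y + x) ^ 2 * g x ^ 2 ∂μ ∂μ := by
        rw [lintegral_lintegral_swap (by fun_prop)]
        simp only [mul_pow]
    _ = C * ∫⁻ x, (∫⁻ y, f y ^ 2 ∂μ) * g x ^ 2 ∂μ := by
        congr 1
        refine lintegral_congr fun x => ?_
        rw [lintegral_mul_const _ (by fun_prop), lintegral_add_right_eq_self (fun y => f y ^ 2) x]
    _ = _ := by rw [lintegral_const_mul _ (by fun_prop), mul_assoc]

omit [SFinite μ] [μ.IsAddLeftInvariant] in
theorem lconvolution_lconvolution_apply (hf : Measurable f) (hg : Measurable g) (h : G → ℝ≥0∞)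
    (ζ : G) :
    ((f ⋆ₗ[μ] g) ⋆ₗ[μ] h) ζ = ∫⁻ y, ∫⁻ x, f x * g (-x + y) * h (-y + ζ) ∂μ ∂μ := by
  simp only [lconvolution_def]
  refine lintegral_congr fun y => ?_
  rw [lintegral_mul_const _ (by fun_prop)]

theorem lintegral_mul_lconvolution {w : G → ℝ≥0∞} (hw : Measurable w) (hf : Measurable f)
    (hg : Measurable g) :
    ∫⁻ ζ, w ζ * (f ⋆ₗ[μ] g) ζ ∂μ = ∫⁻ x, f x * ∫⁻ y, g y * w (x + y) ∂μ ∂μ := by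
  simp only [lconvolution_def]
  calc ∫⁻ ζ, w ζ * ∫⁻ y, f y * g (-y + ζ) ∂μ ∂μ
      = ∫⁻ ζ, ∫⁻ y, w ζ * (f y * g (-y + ζ)) ∂μ ∂μ :=
        lintegral_congr fun ζ => (lintegral_const_mul _ (by fun_prop)).symm
    _ = ∫⁻ y, ∫⁻ ζ, w ζ * (f y * g (-y + ζ)) ∂μ ∂μ := lintegral_lintegral_swap (by fun_prop)
    _ = ∫⁻ x, f x * ∫⁻ y, g y * w (x + y) ∂μ ∂μ := by
        refine lintegral_congr fun x => ?_
        rw [← lintegral_const_mul _ (by fun_prop), ← lintegral_add_left_eq_self _ x]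
        refine lintegral_congr fun y => ?_
        rw [neg_add_cancel_left]
        ring

/-- Young's inequality `‖f * g‖₂ ≤ ‖f‖₁ ‖g‖₂`: Cauchy–Schwarz with respect to the weight `f`. -/
theorem lintegral_sq_lconvolution_le (hf : Measurable f) (hg : Measurable g) :
    ∫⁻ ζ, (f ⋆ₗ[μ] g) ζ ^ 2 ∂μ ≤ (∫⁻ x, f x ∂μ) ^ 2 * ∫⁻ x, g x ^ 2 ∂μ := by
  have hsplit : ∀ y ζ, f y * g (-y + ζ) =
      f y ^ (1 / 2 : ℝ) * (f y ^ (1 / 2 : ℝ) * g (-y + ζ)) := fun y ζ => by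
    rw [← mul_assoc, ← sq, rpow_half_sq]
  calc ∫⁻ ζ, (f ⋆ₗ[μ] g) ζ ^ 2 ∂μ
      ≤ ∫⁻ ζ, (∫⁻ y, f y ∂μ) * ∫⁻ y, f y * g (-y + ζ) ^ 2 ∂μ ∂μ := by
        refine lintegral_mono fun ζ => ?_
        simp only [lconvolution_def, hsplit]
        refine (sq_lintegral_mul_le (by fun_prop) (by fun_prop)).trans (le_of_eq ?_)
        simp only [mul_pow, rpow_half_sq]
    _ = (∫⁻ y, f y ∂μ) * ∫⁻ y, ∫⁻ ζ, f y * g (-y + ζ) ^ 2 ∂μ ∂μ := by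
        rw [lintegral_const_mul _ (by fun_prop), lintegral_lintegral_swap (by fun_prop)]
    _ = (∫⁻ y, f y ∂μ) * ∫⁻ y, f y * ∫⁻ ζ, g ζ ^ 2 ∂μ ∂μ := by
        congr 1
        refine lintegral_congr fun y => ?_
        rw [lintegral_const_mul _ (by fun_prop),
          lintegral_add_left_eq_self (fun ζ => g ζ ^ 2) (-y)]
    _ = _ := by rw [lintegral_mul_const _ hf, sq, mul_assoc]

omit [MeasurableNeg G] [μ.IsAddLeftInvariant] in
theorem lintegral_sq_lintegral_mul_eq (hf : Measurable f) (hg : Measurable g) {e : G → G}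
    (he : Measurable e) :
    ∫⁻ ζ, (∫⁻ y, f (ζ + e y) * g y ∂μ) ^ 2 ∂μ =
      ∫⁻ c, ∫⁻ d, (∫⁻ ζ, f (ζ + e c) * f (ζ + e d) ∂μ) * (g c * g d) ∂μ ∂μ := by
  calc ∫⁻ ζ, (∫⁻ y, f (ζ + e y) * g y ∂μ) ^ 2 ∂μ
      = ∫⁻ ζ, ∫⁻ c, ∫⁻ d, (f (ζ + e c) * f (ζ + e d)) * (g c * g d) ∂μ ∂μ ∂μ := by
        refine lintegral_congr fun ζ => ?_
        rw [sq, ← lintegral_mul_const _ (by fun_prop)]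
        refine lintegral_congr fun c => ?_
        rw [← lintegral_const_mul _ (by fun_prop)]
        refine lintegral_congr fun d => ?_
        ring
    _ = ∫⁻ c, ∫⁻ ζ, ∫⁻ d, (f (ζ + e c) * f (ζ + e d)) * (g c * g d) ∂μ ∂μ ∂μ :=
        lintegral_lintegral_swap (by fun_prop)
    _ = ∫⁻ c, ∫⁻ d, ∫⁻ ζ, (f (ζ + e c) * f (ζ + e d)) * (g c * g d) ∂μ ∂μ ∂μ :=
        lintegral_congr fun c => lintegral_lintegral_swap (by fun_prop)
    _ = _ := by
        refine lintegral_congr fun c => lintegral_congr fun d => ?_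
        rw [lintegral_mul_const _ (by fun_prop)]

variable [μ.IsNegInvariant]

omit [SFinite μ] in
theorem lconvolution_eq_lintegral_sub (f g : G → ℝ≥0∞) (ζ : G) :
    (f ⋆ₗ[μ] g) ζ = ∫⁻ y, f (ζ - y) * g y ∂μ := by
  rw [lconvolution_def, ← lintegral_sub_left_eq_self _ ζ]
  simp

omit [MeasurableAdd₂ G] [SFinite μ] [μ.IsAddLeftInvariant] in
theorem lconvolution_eq_lintegral_add (f g : G → ℝ≥0∞) (ζ : G) :
    (f ⋆ₗ[μ] g) ζ = ∫⁻ y, f (-y) * g (ζ + y) ∂μ := by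
  rw [lconvolution_def, ← lintegral_neg_eq_self]
  simp [add_comm]

/-- On the Fourier side this is `‖u v‖₂ = ‖u (conj v)‖₂`. -/
theorem lintegral_sq_lconvolution_neg_right (hf : Measurable f) (hg : Measurable g) :
    ∫⁻ ζ, (f ⋆ₗ[μ] fun y => g (-y)) ζ ^ 2 ∂μ = ∫⁻ ζ, (f ⋆ₗ[μ] g) ζ ^ 2 ∂μ := by
  have hneg : ∀ ζ, (f ⋆ₗ[μ] fun y => g (-y)) ζ = ∫⁻ y, f (ζ + y) * g y ∂μ := fun ζ => by
    rw [lconvolution_eq_lintegral_sub, ← lintegral_neg_eq_self]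
    simp
  simp only [hneg, lconvolution_eq_lintegral_sub f g, sub_eq_add_neg]
  rw [lintegral_sq_lintegral_mul_eq hf hg measurable_id',
    lintegral_sq_lintegral_mul_eq hf hg measurable_neg]
  refine lintegral_congr fun c => lintegral_congr fun d => ?_
  congr 1
  rw [← lintegral_add_right_eq_self _ (-c + -d)]
  refine lintegral_congr fun ζ => ?_
  rw [mul_comm]
  congr 2 <;> abel

theorem lintegral_sq_lconvolution_neg_left (hf : Measurable f) (hg : Measurable g) :
    ∫⁻ ζ, ((fun y => f (-y)) ⋆ₗ[μ] g) ζ ^ 2 ∂μ = ∫⁻ ζ, (f ⋆ₗ[μ] g) ζ ^ 2 ∂μ := by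
  rw [lconvolution_comm, lintegral_sq_lconvolution_neg_right hg hf, lconvolution_comm]

end Convolution

section Bracket

theorem one_le_japaneseBracket (y : ℝ) : 1 ≤ japaneseBracket y :=
  Real.one_le_sqrt.2 (by nlinarith [sq_nonneg y])

theorem japaneseBracket_pos (y : ℝ) : 0 < japaneseBracket y :=
  one_pos.trans_le (one_le_japaneseBracket y)

theorem japaneseBracket_sq (y : ℝ) : japaneseBracket y ^ 2 = 1 + y ^ 2 :=
  Real.sq_sqrt (by positivity)

theorem japaneseBracket_neg (y : ℝ) : japaneseBracket (-y) = japaneseBracket y := by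
  simp [japaneseBracket]

theorem japaneseBracket_le_of_abs_le {x y : ℝ} (h : |x| ≤ |y|) :
    japaneseBracket x ≤ japaneseBracket y :=
  Real.sqrt_le_sqrt (by linarith [sq_le_sq.2 h])

theorem abs_le_japaneseBracket (y : ℝ) : |y| ≤ japaneseBracket y :=
  Real.abs_le_sqrt (by linarith)

theorem japaneseBracket_le_one_add_abs (y : ℝ) : japaneseBracket y ≤ 1 + |y| := by
  refine Real.sqrt_le_iff.2 ⟨by positivity, ?_⟩
  nlinarith [abs_nonneg y, sq_abs y]

theorem japaneseBracket_add_le (x y : ℝ) :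
    japaneseBracket (x + y) ≤ japaneseBracket x + japaneseBracket y := by
  have hx := abs_le_japaneseBracket x
  have hy := abs_le_japaneseBracket y
  refine Real.sqrt_le_iff.2 ⟨by linarith [abs_nonneg x, abs_nonneg y], ?_⟩
  have h1 : x * y ≤ japaneseBracket x * japaneseBracket y :=
    (le_abs_self _).trans ((abs_mul x y).le.trans
      (mul_le_mul hx hy (abs_nonneg _) (japaneseBracket_pos x).le))
  nlinarith [japaneseBracket_sq x, japaneseBracket_sq y]

theorem japaneseBracket_sub_le (x y : ℝ) :
    japaneseBracket (x - y) ≤ japaneseBracket x + japaneseBracket y := by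
  rw [sub_eq_add_neg, ← japaneseBracket_neg y]
  exact japaneseBracket_add_le _ _

theorem continuous_japaneseBracket : Continuous japaneseBracket := by
  unfold japaneseBracket
  fun_prop

/-- The power `⟨y⟩^p` of the Japanese bracket, as an extended nonnegative number. -/
def bracketPow (p y : ℝ) : ℝ≥0∞ := ENNReal.ofReal (japaneseBracket y ^ p)

@[fun_prop]
theorem measurable_bracketPow (p : ℝ) : Measurable (bracketPow p) :=
  (continuous_japaneseBracket.measurable.pow_const p).ennreal_ofReal

theorem bracketPow_mul (p q y : ℝ) : bracketPow p y * bracketPow q y = bracketPow (p + q) y := by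
  rw [bracketPow, bracketPow, ← ENNReal.ofReal_mul (Real.rpow_nonneg (japaneseBracket_pos y).le _),
    ← Real.rpow_add (japaneseBracket_pos y), bracketPow]

theorem bracketPow_zero (y : ℝ) : bracketPow 0 y = 1 := by simp [bracketPow]

theorem bracketPow_neg_mul_cancel (p y : ℝ) : bracketPow (-p) y * bracketPow p y = 1 := by
  rw [bracketPow_mul, neg_add_cancel, bracketPow_zero]

theorem bracketPow_sq (p y : ℝ) : bracketPow p y ^ 2 = bracketPow (2 * p) y := by
  rw [sq, bracketPow_mul, two_mul]

theorem bracketPow_mono {p q : ℝ} (h : p ≤ q) (y : ℝ) : bracketPow p y ≤ bracketPow q y :=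
  ENNReal.ofReal_le_ofReal (Real.rpow_le_rpow_of_exponent_le (one_le_japaneseBracket y) h)

theorem bracketPow_neg (p y : ℝ) : bracketPow p (-y) = bracketPow p y := by
  rw [bracketPow, japaneseBracket_neg, bracketPow]

theorem bracketPow_eq_enorm (p y : ℝ) : bracketPow p y = ‖((japaneseBracket y ^ p : ℝ) : ℂ)‖ₑ := by
  rw [bracketPow, ← ofReal_norm, Complex.norm_real, Real.norm_of_nonneg
    (Real.rpow_nonneg (japaneseBracket_pos y).le _)]

theorem rpow_neg_le_mul_rpow_neg {c p x y : ℝ} (hp : 0 ≤ p) (hc : 0 < c) (hx : 0 < x)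
    (h : x ≤ c * y) : y ^ (-p) ≤ c ^ p * x ^ (-p) := by
  have hy : 0 < y := pos_of_mul_pos_right (hx.trans_le h) hc.le
  calc y ^ (-p) = c ^ p * (c * y) ^ (-p) := by
        rw [Real.mul_rpow hc.le hy.le, ← mul_assoc, ← Real.rpow_add hc, add_neg_cancel,
          Real.rpow_zero, one_mul]
    _ ≤ c ^ p * x ^ (-p) := mul_le_mul_of_nonneg_left
        (Real.rpow_le_rpow_of_nonpos hx h (neg_nonpos.2 hp)) (by positivity)

theorem japaneseBracket_sum_le {ι : Type*} {t : Finset ι} (ht : t.Nonempty) (k : ι → ℝ) :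
    japaneseBracket (∑ i ∈ t, k i) ≤ ∑ i ∈ t, japaneseBracket (k i) :=
  Finset.le_sum_nonempty_of_subadditive _ japaneseBracket_add_le ht k

theorem bracketPow_le_mul_of_le {c p x y : ℝ} (hp : 0 ≤ p) (hc : 0 ≤ c)
    (h : japaneseBracket x ≤ c * japaneseBracket y) :
    bracketPow p x ≤ ENNReal.ofReal (c ^ p) * bracketPow p y := by
  rw [bracketPow, bracketPow, ← ENNReal.ofReal_mul (by positivity),
    ← Real.mul_rpow hc (japaneseBracket_pos y).le]
  exact ENNReal.ofReal_le_ofReal (Real.rpow_le_rpow (japaneseBracket_pos x).le h hp)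

theorem bracketPow_neg_le_of_le {p x y : ℝ} (hp : 0 ≤ p)
    (h : japaneseBracket x ≤ japaneseBracket y) : bracketPow (-p) y ≤ bracketPow (-p) x :=
  ENNReal.ofReal_le_ofReal
    (Real.rpow_le_rpow_of_nonpos (japaneseBracket_pos x) h (neg_nonpos.2 hp))

theorem bracketPow_neg_le_mul_half {p x y z : ℝ} (hp : 0 ≤ p)
    (hx : japaneseBracket x ≤ japaneseBracket z) (hy : japaneseBracket y ≤ japaneseBracket z) :
    bracketPow (-p) z ≤ bracketPow (-(p / 2)) x * bracketPow (-(p / 2)) y := by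
  calc bracketPow (-p) z = bracketPow (-(p / 2)) z * bracketPow (-(p / 2)) z := by
        rw [bracketPow_mul, ← neg_add, add_halves]
    _ ≤ _ := mul_le_mul' (bracketPow_neg_le_of_le (by positivity) hx)
        (bracketPow_neg_le_of_le (by positivity) hy)

theorem bracketPow_neg_le_one {p : ℝ} (hp : 0 ≤ p) (x : ℝ) : bracketPow (-p) x ≤ 1 :=
  (bracketPow_mono (neg_nonpos.2 hp) x).trans_eq (bracketPow_zero x)

end Bracket

section BracketIntegrals

theorem lintegral_comp_mul_left {g : ℝ → ℝ≥0∞} (hg : Measurable g) {c : ℝ} (hc : c ≠ 0) :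
    ∫⁻ x, g (c * x) = ENNReal.ofReal |c⁻¹| * ∫⁻ x, g x := by
  rw [← lintegral_map (μ := volume) hg (measurable_const_mul c), Real.map_volume_mul_left hc,
    lintegral_smul_measure, smul_eq_mul]

theorem lintegral_comp_two_pi_mul_le {g : ℝ → ℝ≥0∞} (hg : Measurable g) :
    ∫⁻ x, g (2 * Real.pi * x) ≤ ∫⁻ x, g x := by
  rw [lintegral_comp_mul_left hg (by positivity)]
  refine mul_le_of_le_one_left' (ENNReal.ofReal_le_one.2 ?_)
  rw [abs_of_pos (by positivity)]
  exact inv_le_one_of_one_le₀ (by nlinarith [Real.pi_gt_three])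

theorem lintegral_bracketPow_lt_top {q : ℝ} (hq : 1 < q) : ∫⁻ x, bracketPow (-q) x < ∞ := by
  have h := (integrable_rpow_neg_one_add_norm_sq (E := ℝ) (μ := volume) (r := q)
    (by simpa using hq)).lintegral_lt_top
  refine lt_of_le_of_lt (lintegral_mono fun x => le_of_eq ?_) h
  rw [bracketPow, japaneseBracket, Real.sqrt_eq_rpow, ← Real.rpow_mul (by positivity)]
  congr 2
  · rw [Real.norm_eq_abs, sq_abs]
  · ring

theorem lintegral_bracketPow_mul_sub (p : ℝ) {k : ℝ} (hk : k ≠ 0) (y : ℝ) :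
    ∫⁻ x, bracketPow p (k * (x - y)) = ENNReal.ofReal |k⁻¹| * ∫⁻ x, bracketPow p x := by
  rw [lintegral_sub_right_eq_self (fun x => bracketPow p (k * x)) y,
    lintegral_comp_mul_left (by fun_prop) hk]

theorem lintegral_bracketPow_add_mul (p : ℝ) {e : ℝ} (he : e ^ 2 = 1) (B : ℝ) :
    ∫⁻ x, bracketPow p (B + e * x) = ∫⁻ x, bracketPow p x := by
  rcases sq_eq_one_iff.1 he with rfl | rfl
  · simp only [one_mul]
    exact lintegral_add_left_eq_self (bracketPow p) B
  · simp only [neg_one_mul, ← sub_eq_add_neg]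
    exact lintegral_sub_left_eq_self (bracketPow p) B

/-- The larger of `X` and `Y` dominates `D / 2`. -/
theorem rpow_neg_mul_rpow_neg_le {p q X Y D : ℝ} (hp : 0 ≤ p) (hpq : p ≤ q) (hX : 0 < X)
    (hY : 0 < Y) (hD : 0 < D) (h : D ≤ X + Y) :
    X ^ (-p) * Y ^ (-q) ≤ 2 ^ p * D ^ (-p) * (X ^ (-q) + Y ^ (-q)) := by
  rcases le_total Y X with hYX | hXY
  · calc X ^ (-p) * Y ^ (-q) ≤ 2 ^ p * D ^ (-p) * Y ^ (-q) := by
          gcongr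
          exact rpow_neg_le_mul_rpow_neg hp two_pos hD (by linarith)
      _ ≤ _ := by
          gcongr
          exact le_add_of_nonneg_left (by positivity)
  · calc X ^ (-p) * Y ^ (-q) = Y ^ (-p) * (X ^ (-p) * Y ^ (-(q - p))) := by
          rw [mul_left_comm, ← Real.rpow_add hY]
          ring_nf
      _ ≤ Y ^ (-p) * (X ^ (-p) * X ^ (-(q - p))) := by
          have := Real.rpow_le_rpow_of_nonpos hX hXY (neg_nonpos.2 (sub_nonneg.2 hpq))
          gcongr
      _ = Y ^ (-p) * X ^ (-q) := by
          rw [← Real.rpow_add hX]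
          ring_nf
      _ ≤ 2 ^ p * D ^ (-p) * X ^ (-q) := by
          gcongr
          exact rpow_neg_le_mul_rpow_neg hp two_pos hD (by linarith)
      _ ≤ _ := by
          gcongr
          exact le_add_of_nonneg_right (by positivity)

theorem bracketPow_neg_mul_bracketPow_neg_le {p q e : ℝ} (hp : 0 ≤ p) (hpq : p ≤ q)
    (he : e ^ 2 = 1) (x y : ℝ) :
    bracketPow (-p) x * bracketPow (-q) y ≤
      ENNReal.ofReal (2 ^ p) * bracketPow (-p) (x - e * y) *
        (bracketPow (-q) x + bracketPow (-q) y) := by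
  have hey : japaneseBracket (e * y) = japaneseBracket y := by
    simp only [japaneseBracket, mul_pow, he, one_mul]
  have hle : japaneseBracket (x - e * y) ≤ japaneseBracket x + japaneseBracket y :=
    hey ▸ japaneseBracket_sub_le x (e * y)
  have hnonneg : ∀ r z : ℝ, 0 ≤ japaneseBracket z ^ r := fun r z =>
    Real.rpow_nonneg (japaneseBracket_pos z).le r
  simp only [bracketPow]
  rw [← ENNReal.ofReal_mul (hnonneg _ _), ← ENNReal.ofReal_mul (by positivity),
    ← ENNReal.ofReal_add (hnonneg _ _) (hnonneg _ _),
    ← ENNReal.ofReal_mul (mul_nonneg (by positivity) (hnonneg _ _))]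
  exact ENNReal.ofReal_le_ofReal (rpow_neg_mul_rpow_neg_le hp hpq (japaneseBracket_pos _)
    (japaneseBracket_pos _) (japaneseBracket_pos _) hle)

theorem lintegral_bracketPow_mul_le {p q : ℝ} (hp : 0 ≤ p) (hpq : p ≤ q) (hq : 1 < q) :
    ∃ C : ℝ≥0, ∀ e : ℝ, e ^ 2 = 1 → ∀ A B : ℝ,
      ∫⁻ x, bracketPow (-p) (A + x) * bracketPow (-q) (B + e * x) ≤
        C * bracketPow (-p) (A - e * B) := by
  set I := ∫⁻ x, bracketPow (-q) x
  have hI : I ≠ ∞ := (lintegral_bracketPow_lt_top hq).ne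
  refine ⟨(ENNReal.ofReal (2 ^ p) * (I + I)).toNNReal, fun e he A B => ?_⟩
  rw [ENNReal.coe_toNNReal (by finiteness)]
  have hpt : ∀ x, bracketPow (-p) (A + x) * bracketPow (-q) (B + e * x) ≤
      ENNReal.ofReal (2 ^ p) * bracketPow (-p) (A - e * B) *
        (bracketPow (-q) (A + x) + bracketPow (-q) (B + e * x)) := fun x => by
    have h := bracketPow_neg_mul_bracketPow_neg_le hp hpq he (A + x) (B + e * x)
    rwa [show A + x - e * (B + e * x) = A - e * B by linear_combination (-x) * he] at h
  calc _ ≤ ∫⁻ x, ENNReal.ofReal (2 ^ p) * bracketPow (-p) (A - e * B) *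
        (bracketPow (-q) (A + x) + bracketPow (-q) (B + e * x)) := lintegral_mono hpt
    _ = ENNReal.ofReal (2 ^ p) * bracketPow (-p) (A - e * B) * (I + I) := by
        rw [lintegral_const_mul _ (by fun_prop), lintegral_add_left (by fun_prop),
          lintegral_add_left_eq_self (bracketPow (-q)) A, lintegral_bracketPow_add_mul _ he]
    _ = _ := by ring

theorem exists_two_mul_abs_sub_mul_abs_add_le (c : ℝ) :
    ∃ m : ℝ, ∀ x, 2 * (|x - m| * |x + m|) ≤ |c + 2 * x ^ 2| := by
  rcases le_total 0 c with hc | hc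
  · refine ⟨0, fun x => ?_⟩
    rw [sub_zero, add_zero, abs_mul_abs_self, abs_of_nonneg (by positivity)]
    nlinarith
  · refine ⟨Real.sqrt (-c / 2), fun x => le_of_eq ?_⟩
    rw [← abs_mul, ← abs_two, ← abs_mul, abs_two]
    congr 1
    linear_combination (-2) * Real.sq_sqrt (show 0 ≤ -c / 2 by linarith)

theorem japaneseBracket_sq_le_two_mul (y : ℝ) :
    japaneseBracket y ^ 2 ≤ 2 * japaneseBracket (2 * y ^ 2) := by
  refine le_of_sq_le_sq ?_ (mul_pos two_pos (japaneseBracket_pos _)).le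
  rw [mul_pow, japaneseBracket_sq, japaneseBracket_sq]
  nlinarith [sq_nonneg (y ^ 2 - 1), sq_nonneg (y ^ 2)]

theorem bracketPow_neg_le_of_two_mul_sq_le {p y z : ℝ} (hp : 0 ≤ p) (h : 2 * y ^ 2 ≤ |z|) :
    bracketPow (-p) z ≤ ENNReal.ofReal (2 ^ p) * bracketPow (-(2 * p)) y := by
  have hyz : japaneseBracket y ^ 2 ≤ 2 * japaneseBracket z :=
    (japaneseBracket_sq_le_two_mul y).trans (mul_le_mul_of_nonneg_left
      (japaneseBracket_le_of_abs_le (by rwa [abs_of_nonneg (by positivity)])) zero_le_two)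
  rw [bracketPow, bracketPow, ← ENNReal.ofReal_mul (by positivity)]
  refine ENNReal.ofReal_le_ofReal
    ((rpow_neg_le_mul_rpow_neg hp two_pos (pow_pos (japaneseBracket_pos y) 2) hyz).trans_eq ?_)
  rw [← Real.rpow_natCast, ← Real.rpow_mul (japaneseBracket_pos y).le, Nat.cast_ofNat, mul_neg]

/-- The quadratic `c + 2 x²` is bounded below by `2 |x - m|²` or `2 |x + m|²`, where `± m` are its
roots (or `m = 0` if there are none). -/
theorem lintegral_bracketPow_quadratic_le {p : ℝ} (hp : 1 / 2 < p) :
    ∃ C : ℝ≥0, ∀ c d : ℝ, ∫⁻ x, bracketPow (-p) (c + 2 * (x + d) ^ 2) ≤ C := by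
  set I := ∫⁻ x, bracketPow (-(2 * p)) x
  have hI : I ≠ ∞ := (lintegral_bracketPow_lt_top (by linarith)).ne
  refine ⟨(ENNReal.ofReal (2 ^ p) * (I + I)).toNNReal, fun c d => ?_⟩
  rw [ENNReal.coe_toNNReal (by finiteness),
    lintegral_add_right_eq_self (fun x => bracketPow (-p) (c + 2 * x ^ 2)) d]
  obtain ⟨m, hm⟩ := exists_two_mul_abs_sub_mul_abs_add_le c
  have hpt : ∀ x, bracketPow (-p) (c + 2 * x ^ 2) ≤ ENNReal.ofReal (2 ^ p) *
      (bracketPow (-(2 * p)) (x - m) + bracketPow (-(2 * p)) (x + m)) := by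
    intro x
    rcases le_total |x - m| |x + m| with h | h
    · refine (bracketPow_neg_le_of_two_mul_sq_le (y := x - m) (by linarith)
        (le_trans ?_ (hm x))).trans ?_
      · rw [← sq_abs, sq]
        gcongr
      · gcongr
        exact le_self_add
    · refine (bracketPow_neg_le_of_two_mul_sq_le (y := x + m) (by linarith)
        (le_trans ?_ (hm x))).trans ?_
      · rw [← sq_abs, sq]
        gcongr
      · gcongr
        exact le_add_self
  calc _ ≤ ∫⁻ x, ENNReal.ofReal (2 ^ p) *
      (bracketPow (-(2 * p)) (x - m) + bracketPow (-(2 * p)) (x + m)) := lintegral_mono hpt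
    _ = _ := by
        rw [lintegral_const_mul _ (by fun_prop), lintegral_add_left (by fun_prop),
          lintegral_sub_right_eq_self (bracketPow (-(2 * p))) m,
          lintegral_add_right_eq_self (bracketPow (-(2 * p))) m]

theorem low_high_bounds {k x : ℝ} (h : 20 * japaneseBracket x ≤ japaneseBracket (k + x)) :
    1 ≤ |k| ∧ |x| ≤ |k| / 8 ∧ japaneseBracket (k + x) ≤ 3 * |k| := by
  have h₁ := japaneseBracket_le_one_add_abs (k + x)
  have h₂ := abs_add_le k x
  have h₃ := abs_le_japaneseBracket x
  have h₄ := one_le_japaneseBracket x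
  refine ⟨?_, ?_, ?_⟩ <;> linarith

theorem exists_forall_japaneseBracket_le_two_mul {α : Type*} {S : Set α} (hS : S.Nonempty)
    (Φ : α → ℝ) : ∃ y ∈ S, ∀ x ∈ S, japaneseBracket (Φ y) ≤ 2 * japaneseBracket (Φ x) := by
  set F := (fun x => japaneseBracket (Φ x)) '' S
  have hF : 1 ∈ lowerBounds F := by
    rintro _ ⟨x, -, rfl⟩
    exact one_le_japaneseBracket _
  have hinf : 1 ≤ sInf F := le_csInf (hS.image _) hF
  obtain ⟨_, ⟨y, hy, rfl⟩, hlt⟩ :=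
    exists_lt_of_csInf_lt (hS.image _) (show sInf F < 2 * sInf F by linarith)
  refine ⟨y, hy, fun x hx => hlt.le.trans ?_⟩
  gcongr
  exact csInf_le ⟨1, hF⟩ ⟨x, hx, rfl⟩

theorem abs_mul_sub_le_abs_phase_sub {e k x y : ℝ} (he : e ^ 2 = 1) (hx : |x| ≤ |k| / 8)
    (hy : |y| ≤ |k| / 8) (t : ℝ) :
    |k * (x - y)| ≤ |(t + (k + x) ^ 2 - e * x ^ 2) - (t + (k + y) ^ 2 - e * y ^ 2)| := by
  have hfactor : (t + (k + x) ^ 2 - e * x ^ 2) - (t + (k + y) ^ 2 - e * y ^ 2) =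
      (2 * k + (1 - e) * (x + y)) * (x - y) := by ring
  rw [hfactor, abs_mul, abs_mul]
  refine mul_le_mul_of_nonneg_right ?_ (abs_nonneg _)
  have hsmall : |(1 - e) * (x + y)| ≤ 2 * (|k| / 8 + |k| / 8) := by
    rw [abs_mul]
    gcongr
    · rcases sq_eq_one_iff.1 he with rfl | rfl <;> norm_num
    · exact (abs_add_le x y).trans (by linarith)
  have htri := abs_sub_abs_le_abs_sub (2 * k) (-((1 - e) * (x + y)))
  rw [abs_neg, sub_neg_eq_add, abs_mul, abs_two] at htri
  linarith [abs_nonneg k]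

theorem rpow_mul_rpow_neg_le {p q a K L P Y : ℝ} (hp : 0 ≤ p) (hpq : p ≤ q) (ha : 0 ≤ a)
    (hapq : 2 * (q - p) + 2 * a ≤ 1) (hK : 1 ≤ K) (hL : 0 ≤ L) (hP : 0 ≤ P) (hY : 0 < Y)
    (hLK : L ≤ 3 * K) (hYP : Y ≤ 3 * P) (hYK : Y ≤ 2 * K ^ 2) :
    L ^ (2 * a) * P ^ (-p) ≤ 3 ^ (2 * a) * (3 ^ p * 2 ^ (q - p)) * K * Y ^ (-q) := by
  have hK₀ : 0 < K := one_pos.trans_le hK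
  have hLa : L ^ (2 * a) ≤ 3 ^ (2 * a) * K ^ (2 * a) := by
    rw [← Real.mul_rpow zero_le_three hK₀.le]
    exact Real.rpow_le_rpow hL hLK (by linarith)
  have hYq : Y ^ (-p) ≤ 2 ^ (q - p) * K ^ (2 * (q - p)) * Y ^ (-q) := by
    calc Y ^ (-p) = Y ^ (q - p) * Y ^ (-q) := by
          rw [← Real.rpow_add hY]
          ring_nf
      _ ≤ (2 * K ^ 2) ^ (q - p) * Y ^ (-q) := by
          gcongr
      _ = _ := by
          rw [Real.mul_rpow zero_le_two (by positivity), ← Real.rpow_natCast K,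
            ← Real.rpow_mul hK₀.le, Nat.cast_ofNat]
  have hKle : K ^ (2 * a) * K ^ (2 * (q - p)) ≤ K := by
    rw [← Real.rpow_add hK₀]
    exact Real.rpow_le_self_of_one_le hK (by linarith)
  calc L ^ (2 * a) * P ^ (-p)
      ≤ (3 ^ (2 * a) * K ^ (2 * a)) *
        (3 ^ p * (2 ^ (q - p) * K ^ (2 * (q - p)) * Y ^ (-q))) := by
        gcongr
        exact (rpow_neg_le_mul_rpow_neg hp three_pos hY hYP).trans (by gcongr)
    _ = 3 ^ (2 * a) * (3 ^ p * 2 ^ (q - p)) * (K ^ (2 * a) * K ^ (2 * (q - p))) * Y ^ (-q) := by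
        ring
    _ ≤ _ := by gcongr

/-- The phase has slope at least `|k|` on the region in question, so there `⟨Φ x⟩ ≳ ⟨k (x - y)⟩` if
`y` nearly minimizes `⟨Φ⟩`. -/
theorem bracketPow_mul_bracketPow_low_high_le {p q a e k x y : ℝ} (hp : 0 ≤ p) (hpq : p ≤ q)
    (ha : 0 ≤ a) (hapq : 2 * (q - p) + 2 * a ≤ 1) (he : e ^ 2 = 1) (t : ℝ)
    (hx : 20 * japaneseBracket x ≤ japaneseBracket (k + x))
    (hy : 20 * japaneseBracket y ≤ japaneseBracket (k + y))
    (hmin : japaneseBracket (t + (k + y) ^ 2 - e * y ^ 2) ≤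
      2 * japaneseBracket (t + (k + x) ^ 2 - e * x ^ 2)) :
    bracketPow (2 * a) (k + x) * bracketPow (-p) (t + (k + x) ^ 2 - e * x ^ 2) ≤
      ENNReal.ofReal (3 ^ (2 * a) * (3 ^ p * 2 ^ (q - p)) * |k|) *
        bracketPow (-q) (k * (x - y)) := by
  obtain ⟨hk, hyk, -⟩ := low_high_bounds hy
  obtain ⟨-, hxk, hkx⟩ := low_high_bounds hx
  set Φ : ℝ → ℝ := fun x => t + (k + x) ^ 2 - e * x ^ 2
  have hYΦ : japaneseBracket (k * (x - y)) ≤ 3 * japaneseBracket (Φ x) := by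
    have hslope := japaneseBracket_le_of_abs_le (abs_mul_sub_le_abs_phase_sub he hxk hyk t)
    linarith [japaneseBracket_sub_le (Φ x) (Φ y)]
  have hYk : japaneseBracket (k * (x - y)) ≤ 2 * |k| ^ 2 := by
    have hle := japaneseBracket_le_one_add_abs (k * (x - y))
    have hxy : |x - y| ≤ |k| / 4 := (abs_sub x y).trans (by linarith)
    rw [abs_mul] at hle
    nlinarith [mul_le_mul_of_nonneg_left hxy (abs_nonneg k)]
  rw [bracketPow, bracketPow, bracketPow,
    ← ENNReal.ofReal_mul (Real.rpow_nonneg (japaneseBracket_pos _).le _),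
    ← ENNReal.ofReal_mul (by positivity)]
  exact ENNReal.ofReal_le_ofReal (rpow_mul_rpow_neg_le hp hpq ha hapq hk
    (japaneseBracket_pos _).le (japaneseBracket_pos _).le (japaneseBracket_pos _) hkx hYΦ hYk)

theorem lintegral_bracketPow_low_high_le {p q a : ℝ} (hp : 0 ≤ p) (hpq : p ≤ q) (hq : 1 < q)
    (ha : 0 ≤ a) (hapq : 2 * (q - p) + 2 * a ≤ 1) :
    ∃ C : ℝ≥0, ∀ e : ℝ, e ^ 2 = 1 → ∀ t k : ℝ,
      ∫⁻ x in {x | 20 * japaneseBracket x ≤ japaneseBracket (k + x)},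
        bracketPow (2 * a) (k + x) * bracketPow (-p) (t + (k + x) ^ 2 - e * x ^ 2) ≤ C := by
  set I := ∫⁻ x, bracketPow (-q) x
  have hI : I ≠ ∞ := (lintegral_bracketPow_lt_top hq).ne
  set c : ℝ := 3 ^ (2 * a) * (3 ^ p * 2 ^ (q - p))
  refine ⟨(ENNReal.ofReal c * I).toNNReal, fun e he t k => ?_⟩
  rw [ENNReal.coe_toNNReal (by finiteness)]
  set S := {x | 20 * japaneseBracket x ≤ japaneseBracket (k + x)}
  have hS : MeasurableSet S := (isClosed_le (continuous_const.mul continuous_japaneseBracket)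
    (continuous_japaneseBracket.comp (continuous_const_add k))).measurableSet
  set Φ : ℝ → ℝ := fun x => t + (k + x) ^ 2 - e * x ^ 2
  rcases S.eq_empty_or_nonempty with hempty | hne
  · simp [hempty]
  obtain ⟨y, hyS, hy⟩ := exists_forall_japaneseBracket_le_two_mul hne Φ
  have hk₀ : k ≠ 0 := abs_pos.1 (one_pos.trans_le (low_high_bounds hyS).1)
  calc _ ≤ ∫⁻ x in S, ENNReal.ofReal (c * |k|) * bracketPow (-q) (k * (x - y)) :=
        setLIntegral_mono' hS fun x hx =>
          bracketPow_mul_bracketPow_low_high_le hp hpq ha hapq he t hx hyS (hy x hx)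
    _ ≤ ∫⁻ x, ENNReal.ofReal (c * |k|) * bracketPow (-q) (k * (x - y)) :=
        setLIntegral_le_lintegral _ _
    _ = ENNReal.ofReal (c * |k|) * (ENNReal.ofReal |k⁻¹| * I) := by
        rw [lintegral_const_mul _ (by fun_prop), lintegral_bracketPow_mul_sub _ hk₀]
    _ = _ := by
        rw [← mul_assoc, ← ENNReal.ofReal_mul (by positivity), mul_assoc c, ← abs_mul,
          mul_inv_cancel₀ hk₀, abs_one, mul_one]

end BracketIntegrals

section SpaceTime

/-- The angular spatial frequency `k = 2πξ` of `ζ = (τ, ξ)`. -/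
def spatialFreq (ζ : SpaceTime) : ℝ := 2 * Real.pi * ζ.snd

/-- The modulation `e ω + k²`, `ω = 2πτ`; the sign `e = 1` belongs to solutions of the equation and
`e = -1` to their complex conjugates. -/
def modulation (e : ℝ) (ζ : SpaceTime) : ℝ := e * (2 * Real.pi * ζ.fst) + spatialFreq ζ ^ 2

/-- The function `⟨e ω + k²⟩^{-q/2} φ`; the exponent is halved because the estimates concern the
squares of such functions. -/
def modulated (q e : ℝ) (φ : SpaceTime → ℝ≥0∞) (ζ : SpaceTime) : ℝ≥0∞ :=
  bracketPow (-q / 2) (modulation e ζ) * φ ζ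

/-- The function `⟨k⟩^{-s} ⟨e ω + k²⟩^{-q/2} φ`: as `φ` runs through `L²`, these are the Fourier
transforms of the functions in `X^{s,q/2}` if `e = 1`, and of their conjugates if `e = -1`. -/
def weighted (s q e : ℝ) (φ : SpaceTime → ℝ≥0∞) (ζ : SpaceTime) : ℝ≥0∞ :=
  bracketPow (-s) (spatialFreq ζ) * modulated q e φ ζ

@[fun_prop]
theorem continuous_spatialFreq : Continuous spatialFreq := by
  unfold spatialFreq
  fun_prop

@[fun_prop]
theorem continuous_modulation (e : ℝ) : Continuous (modulation e) := by
  unfold modulation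
  fun_prop

@[fun_prop]
theorem measurable_spatialFreq : Measurable spatialFreq := continuous_spatialFreq.measurable

@[fun_prop]
theorem measurable_modulation (e : ℝ) : Measurable (modulation e) :=
  (continuous_modulation e).measurable

@[fun_prop]
theorem measurable_modulated (q e : ℝ) {φ : SpaceTime → ℝ≥0∞} (hφ : Measurable φ) :
    Measurable (modulated q e φ) := by
  unfold modulated
  fun_prop

@[fun_prop]
theorem measurable_weighted (s q e : ℝ) {φ : SpaceTime → ℝ≥0∞} (hφ : Measurable φ) :
    Measurable (weighted s q e φ) := by
  unfold weighted
  fun_prop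

theorem spatialFreq_toLp (τ ξ : ℝ) : spatialFreq (WithLp.toLp 2 (τ, ξ)) = 2 * Real.pi * ξ := rfl

theorem modulation_toLp (e τ ξ : ℝ) :
    modulation e (WithLp.toLp 2 (τ, ξ)) = e * (2 * Real.pi * τ) + (2 * Real.pi * ξ) ^ 2 := rfl

theorem spatialFreq_add (x y : SpaceTime) :
    spatialFreq (x + y) = spatialFreq x + spatialFreq y := by
  simp only [spatialFreq, WithLp.add_snd, mul_add]

theorem spatialFreq_neg (x : SpaceTime) : spatialFreq (-x) = -spatialFreq x := by
  simp [spatialFreq]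

theorem spatialFreq_sum {ι : Type*} (t : Finset ι) (x : ι → SpaceTime) :
    spatialFreq (∑ i ∈ t, x i) = ∑ i ∈ t, spatialFreq (x i) :=
  map_sum (AddMonoidHom.mk' spatialFreq spatialFreq_add) x t

theorem modulation_add_toLp (e : ℝ) (x : SpaceTime) (τ ξ : ℝ) :
    modulation e (x + WithLp.toLp 2 (τ, ξ)) =
      e * (2 * Real.pi * x.fst) + (spatialFreq x + 2 * Real.pi * ξ) ^ 2 +
        e * (2 * Real.pi * τ) := by
  simp only [modulation, spatialFreq, WithLp.add_fst, WithLp.add_snd, WithLp.toLp_fst,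
    WithLp.toLp_snd]
  ring

theorem modulation_sub_toLp (e : ℝ) (x : SpaceTime) (τ ξ : ℝ) :
    modulation e (x - WithLp.toLp 2 (τ, ξ)) =
      e * (2 * Real.pi * x.fst) + (spatialFreq x - 2 * Real.pi * ξ) ^ 2 -
        e * (2 * Real.pi * τ) := by
  simp only [modulation, spatialFreq, WithLp.sub_fst, WithLp.sub_snd, WithLp.toLp_fst,
    WithLp.toLp_snd]
  ring

theorem modulation_neg (e : ℝ) (ζ : SpaceTime) : modulation e (-ζ) = modulation (-e) ζ := by
  simp only [modulation, spatialFreq_neg, WithLp.neg_fst]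
  ring

theorem modulated_neg (q e : ℝ) (φ : SpaceTime → ℝ≥0∞) (ζ : SpaceTime) :
    modulated q e φ (-ζ) = modulated q (-e) (fun x => φ (-x)) ζ := by
  rw [modulated, modulated, modulation_neg]

theorem weighted_neg (s q e : ℝ) (φ : SpaceTime → ℝ≥0∞) (ζ : SpaceTime) :
    weighted s q e φ (-ζ) = weighted s q (-e) (fun x => φ (-x)) ζ := by
  rw [weighted, weighted, spatialFreq_neg, bracketPow_neg, modulated_neg]

theorem weighted_zero (q e : ℝ) (φ : SpaceTime → ℝ≥0∞) : weighted 0 q e φ = modulated q e φ := by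
  funext ζ
  rw [weighted, neg_zero, bracketPow_zero, one_mul]

theorem weighted_le_modulated {s : ℝ} (hs : 0 ≤ s) (q e : ℝ) (φ : SpaceTime → ℝ≥0∞)
    (ζ : SpaceTime) : weighted s q e φ ζ ≤ modulated q e φ ζ :=
  mul_le_of_le_one_left' (bracketPow_neg_le_one hs _)

theorem lintegral_spaceTime {φ : SpaceTime → ℝ≥0∞} (hφ : Measurable φ) :
    ∫⁻ ζ, φ ζ = ∫⁻ ξ : ℝ, ∫⁻ τ : ℝ, φ (WithLp.toLp 2 (τ, ξ)) := by
  have h := WithLp.volume_preserving_toLp ℝ ℝ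
  rw [← h.lintegral_comp hφ, Measure.volume_eq_prod, lintegral_prod_symm]
  exact (hφ.comp h.measurable).aemeasurable

theorem lintegral_sq_weight_le {r q e : ℝ} (he : e ^ 2 = 1) :
    ∫⁻ ζ, (bracketPow (-r) (spatialFreq ζ) * bracketPow (-q / 2) (modulation e ζ)) ^ 2 ≤
      (∫⁻ x, bracketPow (-(2 * r)) x) * ∫⁻ x, bracketPow (-q) x := by
  have htime : ∀ ξ : ℝ, ∫⁻ τ : ℝ, bracketPow (-q) (e * (2 * Real.pi * τ) + ξ ^ 2) ≤
      ∫⁻ x, bracketPow (-q) x := fun ξ => by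
    refine (lintegral_comp_two_pi_mul_le (g := fun x => bracketPow (-q) (e * x + ξ ^ 2))
      (by fun_prop)).trans_eq ?_
    simp only [add_comm (e * _), lintegral_bracketPow_add_mul _ he]
  rw [lintegral_spaceTime (by fun_prop)]
  simp only [mul_pow, bracketPow_sq, mul_div_cancel₀ _ (two_ne_zero' ℝ), mul_neg]
  calc _ ≤ ∫⁻ ξ : ℝ, bracketPow (-(2 * r)) (2 * Real.pi * ξ) * ∫⁻ x, bracketPow (-q) x := by
        refine lintegral_mono fun ξ => ?_
        simp only [spatialFreq_toLp, modulation_toLp]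
        rw [lintegral_const_mul _ (by fun_prop)]
        exact mul_le_mul_right (htime _) _
    _ ≤ _ := by
        rw [lintegral_mul_const _ (by fun_prop)]
        exact mul_le_mul_left (lintegral_comp_two_pi_mul_le (measurable_bracketPow _)) _

theorem sq_lintegral_weighted_le {r q : ℝ} (hr : 1 / 2 < r) (hq : 1 < q) :
    ∃ C : ℝ≥0, ∀ e : ℝ, e ^ 2 = 1 → ∀ φ : SpaceTime → ℝ≥0∞, Measurable φ →
      (∫⁻ ζ, weighted r q e φ ζ) ^ 2 ≤ C * ∫⁻ ζ, φ ζ ^ 2 := by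
  have hfin : (∫⁻ x, bracketPow (-(2 * r)) x) * ∫⁻ x, bracketPow (-q) x ≠ ∞ :=
    ENNReal.mul_ne_top (lintegral_bracketPow_lt_top (by linarith)).ne
      (lintegral_bracketPow_lt_top hq).ne
  lift (∫⁻ x, bracketPow (-(2 * r)) x) * ∫⁻ x, bracketPow (-q) x to ℝ≥0 using hfin with C hC
  refine ⟨C, fun e he φ hφ => ?_⟩
  simp only [weighted, modulated, ← mul_assoc]
  refine (sq_lintegral_mul_le (by fun_prop) hφ.aemeasurable).trans ?_
  gcongr
  exact (lintegral_sq_weight_le he).trans_eq hC.symm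

end SpaceTime

section Bilinear

theorem lintegral_bracketPow_time_le {p q : ℝ} (hp : 0 ≤ p) (hpq : p ≤ q) (hq : 1 < q) :
    ∃ C : ℝ≥0, ∀ e : ℝ, e ^ 2 = 1 → ∀ A B : ℝ,
      ∫⁻ τ, bracketPow (-p) (A + 2 * Real.pi * τ) * bracketPow (-q) (B + e * (2 * Real.pi * τ)) ≤
        C * bracketPow (-p) (A - e * B) := by
  obtain ⟨C, hC⟩ := lintegral_bracketPow_mul_le hp hpq hq
  exact ⟨C, fun e he A B => (lintegral_comp_two_pi_mul_le
    (g := fun x => bracketPow (-p) (A + x) * bracketPow (-q) (B + e * x)) (by fun_prop)).trans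
      (hC e he A B)⟩

/-- On the frequencies `k` and `K - k` the modulations add up to `Ω + K² / 2 + 2 (k - K / 2)²`. -/
theorem lintegral_bracketPow_modulation_mul_le {p q : ℝ} (hp : 1 / 2 < p) (hpq : p ≤ q)
    (hq : 1 < q) :
    ∃ C : ℝ≥0, ∀ ζ : SpaceTime,
      ∫⁻ y, bracketPow (-p) (modulation 1 y) * bracketPow (-q) (modulation 1 (ζ - y)) ≤ C := by
  obtain ⟨C₁, hC₁⟩ := lintegral_bracketPow_time_le (by linarith) hpq hq
  obtain ⟨C₂, hC₂⟩ := lintegral_bracketPow_quadratic_le hp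
  refine ⟨C₁ * C₂, fun ζ => ?_⟩
  set Ω := 2 * Real.pi * ζ.fst
  set K := spatialFreq ζ
  set G : ℝ → ℝ≥0∞ := fun k => bracketPow (-p) (Ω + K ^ 2 / 2 + 2 * (k + -(K / 2)) ^ 2)
  rw [lintegral_spaceTime (by fun_prop)]
  calc _ ≤ ∫⁻ ξ : ℝ, C₁ * G (2 * Real.pi * ξ) := by
        refine lintegral_mono fun ξ => ?_
        refine le_trans (le_of_eq (lintegral_congr fun τ => ?_)) ((hC₁ (-1) (by norm_num)
          ((2 * Real.pi * ξ) ^ 2) (Ω + (K - 2 * Real.pi * ξ) ^ 2)).trans_eq ?_)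
        · rw [modulation_sub_toLp, modulation_toLp, one_mul, one_mul, neg_one_mul,
            ← sub_eq_add_neg, add_comm (2 * Real.pi * τ)]
        · simp only [G]
          congr 2
          ring
    _ ≤ C₁ * C₂ := by
        rw [lintegral_const_mul _ (by fun_prop)]
        gcongr
        exact (lintegral_comp_two_pi_mul_le (g := G) (by fun_prop)).trans (hC₂ _ _)
    _ = ((C₁ * C₂ : ℝ≥0) : ℝ≥0∞) := by push_cast; rfl

theorem lintegral_sq_lconvolution_modulated_one_le {p q : ℝ} (hp : 1 / 2 < p) (hpq : p ≤ q)
    (hq : 1 < q) :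
    ∃ C : ℝ≥0, ∀ f g : SpaceTime → ℝ≥0∞, Measurable f → Measurable g →
      ∫⁻ ζ, (modulated p 1 f ⋆ₗ modulated q 1 g) ζ ^ 2 ≤
        C * (∫⁻ ζ, f ζ ^ 2) * ∫⁻ ζ, g ζ ^ 2 := by
  obtain ⟨C, hC⟩ := lintegral_bracketPow_modulation_mul_le hp hpq hq
  refine ⟨C, fun f g hf hg => ?_⟩
  rw [mul_assoc, mul_comm (∫⁻ ζ, f ζ ^ 2), ← mul_assoc,
    ← lintegral_neg_eq_self (fun ζ => f ζ ^ 2)]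
  refine le_trans (le_of_eq ?_) (lintegral_sq_kernel_le
    (κ := fun ζ y => bracketPow (-p / 2) (modulation 1 (-y)) *
      bracketPow (-q / 2) (modulation 1 (ζ + y))) (by fun_prop) hg
    (g := fun x => f (-x)) (by fun_prop) fun ζ => ?_)
  · refine lintegral_congr fun ζ => ?_
    rw [lconvolution_eq_lintegral_add]
    congr 1
    refine lintegral_congr fun y => ?_
    simp only [modulated]
    ring
  · rw [← lintegral_neg_eq_self]
    simpa only [neg_neg, ← sub_eq_add_neg, mul_pow, bracketPow_sq,
      mul_div_cancel₀ _ (two_ne_zero' ℝ)] using hC ζ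

theorem lintegral_sq_lconvolution_modulated_le {p q : ℝ} (hp : 1 / 2 < p) (hpq : p ≤ q)
    (hq : 1 < q) :
    ∃ C : ℝ≥0, ∀ e₁ e₂ : ℝ, e₁ ^ 2 = 1 → e₂ ^ 2 = 1 → ∀ f g : SpaceTime → ℝ≥0∞,
      Measurable f → Measurable g →
      ∫⁻ ζ, (modulated p e₁ f ⋆ₗ modulated q e₂ g) ζ ^ 2 ≤
        C * (∫⁻ ζ, f ζ ^ 2) * ∫⁻ ζ, g ζ ^ 2 := by
  obtain ⟨C, hC⟩ := lintegral_sq_lconvolution_modulated_one_le hp hpq hq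
  have hleft : ∀ e : ℝ, e ^ 2 = 1 → ∀ f g : SpaceTime → ℝ≥0∞, Measurable f → Measurable g →
      ∫⁻ ζ, (modulated p e f ⋆ₗ modulated q 1 g) ζ ^ 2 ≤
        C * (∫⁻ ζ, f ζ ^ 2) * ∫⁻ ζ, g ζ ^ 2 := by
    intro e he f g hf hg
    rcases sq_eq_one_iff.1 he with rfl | rfl
    · exact hC f g hf hg
    · rw [← lintegral_sq_lconvolution_neg_left (by fun_prop) (by fun_prop),
        ← lintegral_neg_eq_self (fun ζ => f ζ ^ 2)]
      simp only [modulated_neg, neg_neg]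
      exact hC (fun x => f (-x)) g (by fun_prop) hg
  refine ⟨C, fun e₁ e₂ he₁ he₂ f g hf hg => ?_⟩
  rcases sq_eq_one_iff.1 he₂ with rfl | rfl
  · exact hleft e₁ he₁ f g hf hg
  · rw [← lintegral_sq_lconvolution_neg_right (by fun_prop) (by fun_prop),
      ← lintegral_neg_eq_self (fun ζ => g ζ ^ 2)]
    simp only [modulated_neg, neg_neg]
    exact hleft e₁ he₁ f (fun x => g (-x)) hf (by fun_prop)

/-- The multiplier `⟨k₀⟩^a`, restricted to the region where `⟨k⟩` is much smaller than `⟨k₀⟩`. -/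
def lowHighWeight (a k₀ k : ℝ) : ℝ≥0∞ :=
  if 20 * japaneseBracket k ≤ japaneseBracket k₀ then bracketPow a k₀ else 0

/-- The multiplier `1 + ⟨k₀⟩^a` where `⟨k⟩` is much smaller than `⟨k₀⟩`, and `1` elsewhere. It
measures how many derivatives the quintilinear estimate gains if `k₀` is the frequency of the
output and `k` the smallest frequency of the inputs. -/
def gainWeight (a k₀ k : ℝ) : ℝ≥0∞ := 1 + lowHighWeight a k₀ k

theorem lowHighWeight_sq (a k₀ k : ℝ) : lowHighWeight a k₀ k ^ 2 = lowHighWeight (2 * a) k₀ k := by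
  simp only [lowHighWeight, ite_pow, bracketPow_sq, zero_pow two_ne_zero]

@[fun_prop]
theorem measurable_lowHighWeight {α : Type*} [MeasurableSpace α] (a : ℝ) {f g : α → ℝ}
    (hf : Measurable f) (hg : Measurable g) :
    Measurable fun z => lowHighWeight a (f z) (g z) := by
  have := continuous_japaneseBracket.measurable
  exact Measurable.ite (measurableSet_le (by fun_prop) (by fun_prop)) (by fun_prop)
    measurable_const

@[fun_prop]
theorem measurable_gainWeight {α : Type*} [MeasurableSpace α] (a : ℝ) {f g : α → ℝ}
    (hf : Measurable f) (hg : Measurable g) : Measurable fun z => gainWeight a (f z) (g z) := by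
  unfold gainWeight
  fun_prop

theorem lintegral_lowHighWeight_mul_bracketPow_le {p q a : ℝ} (hp : 0 ≤ p) (hpq : p ≤ q)
    (hq : 1 < q) (ha : 0 ≤ a) (hapq : 2 * (q - p) + 2 * a ≤ 1) :
    ∃ C : ℝ≥0, ∀ e : ℝ, e ^ 2 = 1 → ∀ t k : ℝ,
      ∫⁻ x, lowHighWeight (2 * a) (k + x) x *
        bracketPow (-p) (t + (k + x) ^ 2 - e * x ^ 2) ≤ C := by
  obtain ⟨C, hC⟩ := lintegral_bracketPow_low_high_le hp hpq hq ha hapq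
  refine ⟨C, fun e he t k => le_trans (le_of_eq ?_) (hC e he t k)⟩
  have := continuous_japaneseBracket.measurable
  rw [← lintegral_indicator (measurableSet_le (by fun_prop) (by fun_prop))]
  refine lintegral_congr fun x => ?_
  simp only [lowHighWeight, Set.indicator_apply, Set.mem_ofPred_eq, ite_mul, zero_mul]

variable {p q q' a : ℝ}

theorem lintegral_sq_lowHighWeight_mul_le (hp : 0 ≤ p) (hpq : p ≤ q) (hq : 1 < q)
    (hpq' : p ≤ q') (hq' : 1 < q') (ha : 0 ≤ a) (hapq : 2 * (q' - p) + 2 * a ≤ 1) :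
    ∃ C : ℝ≥0, ∀ e : ℝ, e ^ 2 = 1 → ∀ y : SpaceTime,
      ∫⁻ x, (lowHighWeight a (spatialFreq (y + x)) (spatialFreq x) *
        (bracketPow (-p / 2) (modulation 1 (y + x)) *
          bracketPow (-q / 2) (modulation e x))) ^ 2 ≤ C := by
  obtain ⟨C₁, hC₁⟩ := lintegral_bracketPow_time_le hp hpq hq
  obtain ⟨C₂, hC₂⟩ := lintegral_lowHighWeight_mul_bracketPow_le hp hpq' hq' ha hapq
  refine ⟨C₁ * C₂, fun e he y => ?_⟩
  set Ω := 2 * Real.pi * y.fst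
  set K := spatialFreq y
  set G : ℝ → ℝ≥0∞ := fun k =>
    lowHighWeight (2 * a) (K + k) k * bracketPow (-p) (Ω + (K + k) ^ 2 - e * k ^ 2)
  simp only [mul_pow, lowHighWeight_sq, bracketPow_sq, mul_div_cancel₀ _ (two_ne_zero' ℝ)]
  rw [lintegral_spaceTime (by fun_prop)]
  calc _ ≤ ∫⁻ ξ : ℝ, C₁ * G (2 * Real.pi * ξ) := by
        refine lintegral_mono fun ξ => ?_
        simp only [modulation_add_toLp, modulation_toLp, spatialFreq_add, spatialFreq_toLp]
        simp only [one_mul, add_comm (e * _)]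
        rw [lintegral_const_mul _ (by fun_prop)]
        exact (mul_le_mul_right (hC₁ e he _ _) _).trans_eq (mul_left_comm _ _ _)
    _ ≤ C₁ * C₂ := by
        rw [lintegral_const_mul _ (by fun_prop)]
        gcongr
        exact (lintegral_comp_two_pi_mul_le (g := G) (by fun_prop)).trans (hC₂ e he _ _)
    _ = ((C₁ * C₂ : ℝ≥0) : ℝ≥0∞) := by push_cast; rfl

theorem lintegral_sq_lowHighWeight_modulated_le (hp : 0 ≤ p) (hpq : p ≤ q) (hq : 1 < q)
    (hpq' : p ≤ q') (hq' : 1 < q') (ha : 0 ≤ a) (hapq : 2 * (q' - p) + 2 * a ≤ 1) :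
    ∃ C : ℝ≥0, ∀ e : ℝ, e ^ 2 = 1 → ∀ w f : SpaceTime → ℝ≥0∞, Measurable w → Measurable f →
      ∫⁻ y, (∫⁻ x, lowHighWeight a (spatialFreq (y + x)) (spatialFreq x) *
        (modulated p 1 w (y + x) * modulated q e f x)) ^ 2 ≤
        C * (∫⁻ ζ, w ζ ^ 2) * ∫⁻ ζ, f ζ ^ 2 := by
  obtain ⟨C, hC⟩ := lintegral_sq_lowHighWeight_mul_le hp hpq hq hpq' hq' ha hapq
  refine ⟨C, fun e he w f hw hf => ?_⟩
  refine le_trans (le_of_eq ?_) (lintegral_sq_kernel_le (f := w) (g := f)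
    (κ := fun y x => lowHighWeight a (spatialFreq (y + x)) (spatialFreq x) *
      (bracketPow (-p / 2) (modulation 1 (y + x)) * bracketPow (-q / 2) (modulation e x)))
    (by fun_prop) hw hf (hC e he))
  refine lintegral_congr fun y => ?_
  congr 1
  refine lintegral_congr fun x => ?_
  simp only [modulated]
  ring

theorem lintegral_sq_gainWeight_modulated_le (hp : 1 / 2 < p) (hpq : p ≤ q) (hq : 1 < q)
    (hpq' : p ≤ q') (hq' : 1 < q') (ha : 0 ≤ a) (hapq : 2 * (q' - p) + 2 * a ≤ 1) :
    ∃ C : ℝ≥0, ∀ e : ℝ, e ^ 2 = 1 → ∀ w f : SpaceTime → ℝ≥0∞, Measurable w → Measurable f →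
      ∫⁻ y, (∫⁻ x, gainWeight a (spatialFreq (y + x)) (spatialFreq x) *
        (modulated p 1 w (y + x) * modulated q e f x)) ^ 2 ≤
        C * (∫⁻ ζ, w ζ ^ 2) * ∫⁻ ζ, f ζ ^ 2 := by
  obtain ⟨C₁, hC₁⟩ := lintegral_sq_lconvolution_modulated_le hp hpq hq
  obtain ⟨C₂, hC₂⟩ :=
    lintegral_sq_lowHighWeight_modulated_le (by linarith) hpq hq hpq' hq' ha hapq
  refine ⟨2 * (C₁ + C₂), fun e he w f hw hf => ?_⟩
  set J : SpaceTime → ℝ≥0∞ := fun y => ∫⁻ x, modulated p 1 w (y + x) * modulated q e f x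
  set L : SpaceTime → ℝ≥0∞ := fun y => ∫⁻ x,
    lowHighWeight a (spatialFreq (y + x)) (spatialFreq x) *
      (modulated p 1 w (y + x) * modulated q e f x)
  have hJ : ∫⁻ y, J y ^ 2 ≤ C₁ * (∫⁻ ζ, w ζ ^ 2) * ∫⁻ ζ, f ζ ^ 2 := by
    refine le_trans (le_of_eq ?_) (hC₁ 1 e (one_pow 2) he w f hw hf)
    rw [← lintegral_sq_lconvolution_neg_right (by fun_prop) (by fun_prop), lconvolution_comm]
    simp only [J, lconvolution_eq_lintegral_add, neg_neg, mul_comm]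
  have hJm : Measurable J := by fun_prop
  calc _ = ∫⁻ y, (J y + L y) ^ 2 := by
        refine lintegral_congr fun y => ?_
        rw [← lintegral_add_left (by fun_prop)]
        simp only [gainWeight, add_mul, one_mul]
    _ ≤ ∫⁻ y, 2 * (J y ^ 2 + L y ^ 2) := lintegral_mono fun y => add_sq_le_two_mul_add_sq _ _
    _ = 2 * ((∫⁻ y, J y ^ 2) + ∫⁻ y, L y ^ 2) := by
        rw [lintegral_const_mul' _ _ ENNReal.ofNat_ne_top, lintegral_add_left (by fun_prop)]
    _ ≤ 2 * (C₁ * (∫⁻ ζ, w ζ ^ 2) * (∫⁻ ζ, f ζ ^ 2) +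
          C₂ * (∫⁻ ζ, w ζ ^ 2) * ∫⁻ ζ, f ζ ^ 2) := by
        gcongr
        exact hC₂ e he w f hw hf
    _ = _ := by
        push_cast
        ring

end Bilinear

section WeightInequality

variable {s a c r : ℝ} {k : Fin 5 → ℝ}

/-- The largest factor `⟨k 4⟩^{-s}` absorbs `⟨r⟩^s`, and half of the decay of `⟨k 3⟩^{-s}` is given
to each of the frequencies `k 1` and `k 2`. -/
theorem bracketPow_mul_prod_le_of_le_largest (hs : 0 ≤ s) (hc : 0 ≤ c)
    (hk : Monotone fun i => japaneseBracket (k i))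
    (hr : japaneseBracket r ≤ c * japaneseBracket (k 4)) :
    bracketPow (s + a) r * ∏ i, bracketPow (-s) (k i) ≤
      ENNReal.ofReal (c ^ s) * (bracketPow a r *
        (bracketPow (-(3 * s / 2)) (k 1) * bracketPow (-(3 * s / 2)) (k 2))) := by
  have h13 : japaneseBracket (k 1) ≤ japaneseBracket (k 3) := hk (by decide)
  have h23 : japaneseBracket (k 2) ≤ japaneseBracket (k 3) := hk (by decide)
  have hexp : -(3 * s / 2) = -s + -(s / 2) := by ring
  rw [Fin.prod_univ_five, ← bracketPow_mul s a r, hexp]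
  simp only [← bracketPow_mul (-s)]
  calc _ ≤ ENNReal.ofReal (c ^ s) * bracketPow s (k 4) * bracketPow a r *
        (1 * bracketPow (-s) (k 1) * bracketPow (-s) (k 2) *
          (bracketPow (-(s / 2)) (k 1) * bracketPow (-(s / 2)) (k 2)) * bracketPow (-s) (k 4)) := by
        gcongr
        · exact bracketPow_le_mul_of_le hs hc hr
        · exact bracketPow_neg_le_one hs _
        · exact bracketPow_neg_le_mul_half hs h13 h23
    _ = (bracketPow (-s) (k 4) * bracketPow s (k 4)) * (ENNReal.ofReal (c ^ s) *
          (bracketPow a r * (bracketPow (-s) (k 1) * bracketPow (-(s / 2)) (k 1) *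
            (bracketPow (-s) (k 2) * bracketPow (-(s / 2)) (k 2))))) := by ring
    _ = _ := by rw [bracketPow_neg_mul_cancel, one_mul]

/-- The two smallest factors `⟨k 0⟩^{-s} ⟨k 1⟩^{-s}` absorb `⟨r⟩^{s+a}`, and the decay of the other
three is shared by the frequencies `k 1` and `k 2`. -/
theorem bracketPow_mul_prod_le_of_le_smallest (ha : 0 ≤ a) (has : a ≤ s) (hc : 0 ≤ c)
    (hk : Monotone fun i => japaneseBracket (k i))
    (hr : japaneseBracket r ≤ c * japaneseBracket (k 0)) :
    bracketPow (s + a) r * ∏ i, bracketPow (-s) (k i) ≤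
      ENNReal.ofReal (c ^ (s + a)) *
        (bracketPow (-(3 * s / 2)) (k 1) * bracketPow (-(3 * s / 2)) (k 2)) := by
  have hs : 0 ≤ s := ha.trans has
  have h01 : japaneseBracket (k 0) ≤ 1 * japaneseBracket (k 1) := by
    rw [one_mul]
    exact hk (by decide)
  have hR : bracketPow (s + a) r ≤
      ENNReal.ofReal (c ^ (s + a)) * (bracketPow s (k 0) * bracketPow s (k 1)) := by
    refine (bracketPow_le_mul_of_le (by positivity) hc hr).trans ?_
    rw [← bracketPow_mul]
    gcongr
    calc bracketPow a (k 0) ≤ ENNReal.ofReal (1 ^ a) * bracketPow a (k 1) :=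
          bracketPow_le_mul_of_le ha zero_le_one h01
      _ ≤ bracketPow s (k 1) := by
          rw [Real.one_rpow, ENNReal.ofReal_one, one_mul]
          exact bracketPow_mono has _
  have hhalf : ∀ i, 2 ≤ i →
      bracketPow (-s) (k i) ≤ bracketPow (-(s / 2)) (k 1) * bracketPow (-(s / 2)) (k 2) :=
    fun i hi => bracketPow_neg_le_mul_half hs (hk ((by decide : (1 : Fin 5) ≤ 2).trans hi)) (hk hi)
  have hexp : -(3 * s / 2) = -(s / 2) + -(s / 2) + -(s / 2) := by ring
  rw [Fin.prod_univ_five, hexp]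
  simp only [← bracketPow_mul]
  set b₁ := bracketPow (-(s / 2)) (k 1)
  set b₂ := bracketPow (-(s / 2)) (k 2)
  calc _ ≤ ENNReal.ofReal (c ^ (s + a)) * (bracketPow s (k 0) * bracketPow s (k 1)) *
        (bracketPow (-s) (k 0) * bracketPow (-s) (k 1) * (b₁ * b₂) * (b₁ * b₂) * (b₁ * b₂)) := by
        rw [bracketPow_mul s a]
        gcongr
        · exact hhalf 2 le_rfl
        · exact hhalf 3 (by decide)
        · exact hhalf 4 (by decide)
    _ = (bracketPow (-s) (k 0) * bracketPow s (k 0)) *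
          (bracketPow (-s) (k 1) * bracketPow s (k 1)) *
          (ENNReal.ofReal (c ^ (s + a)) * (b₁ * b₁ * b₁ * (b₂ * b₂ * b₂))) := by ring
    _ = _ := by simp only [bracketPow_neg_mul_cancel, one_mul]

theorem bracketPow_sum_mul_prod_le_of_monotone (ha : 0 ≤ a) (has : a ≤ s)
    (hk : Monotone fun i => japaneseBracket (k i)) :
    bracketPow (s + a) (∑ i, k i) * ∏ i, bracketPow (-s) (k i) ≤
      ENNReal.ofReal (20 ^ (s + a)) * (gainWeight a (∑ i, k i) (k 0) *
        (bracketPow (-(3 * s / 2)) (k 1) * bracketPow (-(3 * s / 2)) (k 2))) := by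
  have hs : 0 ≤ s := ha.trans has
  have hsum : japaneseBracket (∑ i, k i) ≤ 5 * japaneseBracket (k 4) := by
    refine (japaneseBracket_sum_le Finset.univ_nonempty k).trans ?_
    simpa using Finset.sum_le_card_nsmul Finset.univ _ _ fun i _ => hk (Fin.le_last i)
  rw [gainWeight, lowHighWeight]
  split_ifs with hlow
  · refine (bracketPow_mul_prod_le_of_le_largest hs (by norm_num) hk hsum).trans ?_
    gcongr
    · exact (Real.rpow_le_rpow (by norm_num) (by norm_num) hs).trans
        (Real.rpow_le_rpow_of_exponent_le (by norm_num) (le_add_of_nonneg_right ha))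
    · exact le_add_self
  · rw [add_zero, one_mul]
    exact bracketPow_mul_prod_le_of_le_smallest ha has (by norm_num) hk (not_le.1 hlow).le

/-- `ρ` puts the smallest bracket at `4` and the two next ones at `0` and `1`. -/
theorem exists_perm_bracketPow_sum_mul_prod_le (ha : 0 ≤ a) (has : a ≤ s) (k : Fin 5 → ℝ) :
    ∃ ρ : Equiv.Perm (Fin 5), bracketPow (s + a) (∑ i, k i) * ∏ i, bracketPow (-s) (k i) ≤
      ENNReal.ofReal (20 ^ (s + a)) * (gainWeight a (∑ i, k i) (k (ρ 4)) *
        ∏ i, bracketPow (-(![3 * s / 2, 3 * s / 2, 0, 0, 0] i)) (k (ρ i))) := by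
  set σ := Tuple.sort fun i => japaneseBracket (k i)
  refine ⟨(finRotate 5).trans σ, ?_⟩
  have h := bracketPow_sum_mul_prod_le_of_monotone (k := k ∘ σ) ha has
    (Tuple.monotone_sort fun i => japaneseBracket (k i))
  simp only [Function.comp_apply, Equiv.sum_comp σ k,
    Equiv.prod_comp σ fun i => bracketPow (-s) (k i)] at h
  refine h.trans_eq ?_
  simp only [Fin.prod_univ_five, Matrix.cons_val, neg_zero, bracketPow_zero, mul_one]
  rfl

end WeightInequality

section PiIntegrals

variable {E : Type*} [MeasureSpace E] [SigmaFinite (volume : Measure E)]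

theorem lintegral_pi_fin_succ {n : ℕ} {H : (Fin (n + 1) → E) → ℝ≥0∞} (hH : Measurable H) :
    ∫⁻ x, H x = ∫⁻ y : E, ∫⁻ z : Fin n → E, H (Fin.cons y z) := by
  have h := (volume_preserving_piFinSuccAbove (fun _ : Fin (n + 1) => E) 0).symm
  rw [← h.lintegral_comp hH, Measure.volume_eq_prod, lintegral_prod]
  · refine lintegral_congr fun y => lintegral_congr fun z => ?_
    rw [← Fin.insertNth_zero']
    rfl
  · exact (hH.comp h.measurable).aemeasurable

omit [SigmaFinite (volume : Measure E)] in
theorem measurable_cons_right {n : ℕ} (y : E) :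
    Measurable fun z : Fin n → E => (Fin.cons y z : Fin (n + 1) → E) := by
  refine measurable_pi_iff.2 (Fin.cases ?_ fun j => ?_)
  · simp
  · simpa using measurable_pi_apply j

theorem lintegral_pi_fin_five {H : (Fin 5 → E) → ℝ≥0∞} (hH : Measurable H) :
    ∫⁻ x, H x =
      ∫⁻ x₀ : E, ∫⁻ x₁ : E, ∫⁻ x₂ : E, ∫⁻ x₃ : E, ∫⁻ x₄ : E, H ![x₀, x₁, x₂, x₃, x₄] := by
  have hcons : ∀ {n : ℕ} {G : (Fin (n + 1) → E) → ℝ≥0∞}, Measurable G → ∀ y : E,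
      Measurable fun z : Fin n → E => G (Fin.cons y z) :=
    fun hG y => hG.comp (measurable_cons_right y)
  rw [lintegral_pi_fin_succ hH]
  refine lintegral_congr fun x₀ => ?_
  have h₀ := hcons hH x₀
  rw [lintegral_pi_fin_succ h₀]
  refine lintegral_congr fun x₁ => ?_
  have h₁ := hcons h₀ x₁
  rw [lintegral_pi_fin_succ h₁]
  refine lintegral_congr fun x₂ => ?_
  have h₂ := hcons h₁ x₂
  rw [lintegral_pi_fin_succ h₂]
  refine lintegral_congr fun x₃ => ?_
  rw [lintegral_pi_fin_succ (hcons h₂ x₃)]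
  refine lintegral_congr fun x₄ => ?_
  rw [volume_pi, Measure.pi_of_empty, lintegral_dirac]
  congr 1

theorem lintegral_comp_perm {ι : Type*} [Fintype ι] (ρ : Equiv.Perm ι) (F : (ι → E) → ℝ≥0∞) :
    ∫⁻ x, F (x ∘ ρ) = ∫⁻ x, F x := by
  rw [← (volume_measurePreserving_piCongrLeft (fun _ : ι => E) ρ.symm).lintegral_comp_emb
    (MeasurableEquiv.measurableEmbedding _) F]
  refine lintegral_congr fun x => congrArg F (funext fun i => ?_)
  rw [MeasurableEquiv.coe_piCongrLeft, Function.comp_apply]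
  simpa using (Equiv.piCongrLeft_apply_apply (fun _ : ι => E) ρ.symm x (ρ i)).symm

variable [AddCommGroup E] [MeasurableAdd₂ E] {F : Fin 5 → E → ℝ≥0∞}

theorem lintegral_fin_five_mul_prod {H : E → E → ℝ≥0∞} (hH : Measurable (Function.uncurry H))
    (hF : ∀ i, Measurable (F i)) :
    ∫⁻ x : Fin 5 → E, H (∑ i, x i) (x 4) * ∏ i, F i (x i) =
      ∫⁻ x₀, F 0 x₀ * ∫⁻ x₁, F 1 x₁ * ∫⁻ x₂, F 2 x₂ * ∫⁻ x₃, F 3 x₃ *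
        ∫⁻ x₄, F 4 x₄ * H (x₀ + x₁ + (x₂ + x₃) + x₄) x₄ := by
  have h₄ := hF 4
  rw [lintegral_pi_fin_five (by fun_prop)]
  refine lintegral_congr fun x₀ => ?_
  rw [← lintegral_const_mul _ (by fun_prop)]
  refine lintegral_congr fun x₁ => ?_
  rw [← mul_assoc, ← lintegral_const_mul _ (by fun_prop)]
  refine lintegral_congr fun x₂ => ?_
  rw [← mul_assoc, ← lintegral_const_mul _ (by fun_prop)]
  refine lintegral_congr fun x₃ => ?_
  rw [← mul_assoc, ← lintegral_const_mul _ (by fun_prop)]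
  refine lintegral_congr fun x₄ => ?_
  simp only [Fin.sum_univ_five, Fin.prod_univ_five, Matrix.cons_val, ← add_assoc]
  ring

variable [(volume : Measure E).IsAddLeftInvariant]

theorem sq_lintegral_mul_lintegral_mul_le [MeasurableNeg E] {f g B : E → ℝ≥0∞}
    (hf : Measurable f) (hg : Measurable g) (hB : Measurable B) (c : E) :
    (∫⁻ x, f x * ∫⁻ y, g y * B (c + (x + y))) ^ 2 ≤
      (∫⁻ x, (f ⋆ₗ g) x ^ 2) * ∫⁻ x, B x ^ 2 := by
  rw [← lintegral_mul_lconvolution (w := fun x => B (c + x)) (by fun_prop) hf hg, mul_comm,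
    ← lintegral_add_left_eq_self (fun x => B x ^ 2) c]
  exact sq_lintegral_mul_le (by fun_prop) (measurable_lconvolution _ hf hg).aemeasurable

theorem sq_lintegral_fin_five_le [MeasurableNeg E] {H : E → E → ℝ≥0∞}
    (hH : Measurable (Function.uncurry H)) (hF : ∀ i, Measurable (F i)) :
    (∫⁻ x : Fin 5 → E, H (∑ i, x i) (x 4) * ∏ i, F i (x i)) ^ 2 ≤
      (∫⁻ x, F 0 x) ^ 2 * (∫⁻ x, F 1 x) ^ 2 *
        ((∫⁻ x, (F 2 ⋆ₗ F 3) x ^ 2) * ∫⁻ y, (∫⁻ x, F 4 x * H (y + x) x) ^ 2) := by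
  have h₄ := hF 4
  set B : E → ℝ≥0∞ := fun y => ∫⁻ x, F 4 x * H (y + x) x
  set X := (∫⁻ x, (F 2 ⋆ₗ F 3) x ^ 2) * ∫⁻ y, B y ^ 2
  have hB : Measurable B := by fun_prop
  rw [lintegral_fin_five_mul_prod hH hF]
  calc _ ≤ (∫⁻ x₀, F 0 x₀ * ∫⁻ x₁, F 1 x₁ * X ^ (1 / 2 : ℝ)) ^ 2 := by
        gcongr with x₀ x₁
        exact le_rpow_half_of_sq_le (sq_lintegral_mul_lintegral_mul_le (hF 2) (hF 3) hB _)
    _ = _ := by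
        rw [lintegral_mul_const _ (hF 1), lintegral_mul_const _ (hF 0), mul_pow, mul_pow,
          rpow_half_sq, mul_assoc]

end PiIntegrals

section Quintilinear

/-- The integrand of the quintilinear form in dual form, for a configuration of frequencies in
which `x 4` is the smallest; `w` is the dual function. -/
def orderedIntegrand (p q a r : ℝ) (e : Fin 5 → ℝ) (w : SpaceTime → ℝ≥0∞)
    (φ : Fin 5 → SpaceTime → ℝ≥0∞) (x : Fin 5 → SpaceTime) : ℝ≥0∞ :=
  gainWeight a (spatialFreq (∑ i, x i)) (spatialFreq (x 4)) * modulated p 1 w (∑ i, x i) *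
    ∏ i, weighted (![r, r, 0, 0, 0] i) q (e i) (φ i) (x i)

variable {s p q q' a r : ℝ}

/-- The first two functions are estimated in `L¹`, the next two by the bilinear `L²` estimate, and
the last one together with the dual function. -/
theorem sq_lintegral_orderedIntegrand_le (hp : 1 / 2 < p) (hpq : p ≤ q) (hq : 1 < q)
    (hpq' : p ≤ q') (hq' : 1 < q') (ha : 0 ≤ a) (hapq : 2 * (q' - p) + 2 * a ≤ 1)
    (hr : 1 / 2 < r) :
    ∃ C : ℝ≥0, ∀ e : Fin 5 → ℝ, (∀ i, e i ^ 2 = 1) → ∀ (w : SpaceTime → ℝ≥0∞)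
      (φ : Fin 5 → SpaceTime → ℝ≥0∞), Measurable w → (∀ i, Measurable (φ i)) →
      (∫⁻ x, orderedIntegrand p q a r e w φ x) ^ 2 ≤
        C * ((∫⁻ ζ, w ζ ^ 2) * ∏ i, ∫⁻ ζ, φ i ζ ^ 2) := by
  obtain ⟨C₁, hC₁⟩ := sq_lintegral_weighted_le hr hq
  obtain ⟨C₂, hC₂⟩ := lintegral_sq_lconvolution_modulated_le (hp.trans_le hpq) le_rfl hq
  obtain ⟨C₃, hC₃⟩ := lintegral_sq_gainWeight_modulated_le hp hpq hq hpq' hq' ha hapq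
  refine ⟨C₁ * C₁ * C₂ * C₃, fun e he w φ hw hφ => ?_⟩
  refine (sq_lintegral_fin_five_le (F := fun i => weighted (![r, r, 0, 0, 0] i) q (e i) (φ i))
    (H := fun y x => gainWeight a (spatialFreq y) (spatialFreq x) * modulated p 1 w y)
    (by fun_prop) fun i => measurable_weighted _ _ _ (hφ i)).trans ?_
  simp only [Matrix.cons_val, weighted_zero]
  calc _ ≤ (C₁ * ∫⁻ ζ, φ 0 ζ ^ 2) * (C₁ * ∫⁻ ζ, φ 1 ζ ^ 2) *
        ((C₂ * (∫⁻ ζ, φ 2 ζ ^ 2) * ∫⁻ ζ, φ 3 ζ ^ 2) *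
          (C₃ * (∫⁻ ζ, w ζ ^ 2) * ∫⁻ ζ, φ 4 ζ ^ 2)) := by
        gcongr
        · exact hC₁ _ (he 0) _ (hφ 0)
        · exact hC₁ _ (he 1) _ (hφ 1)
        · exact hC₂ _ _ (he 2) (he 3) _ _ (hφ 2) (hφ 3)
        · refine le_trans (le_of_eq ?_) (hC₃ _ (he 4) _ _ hw (hφ 4))
          refine lintegral_congr fun y => congrArg (· ^ 2) (lintegral_congr fun x => ?_)
          rw [mul_comm, mul_assoc]
    _ = _ := by
        rw [Fin.prod_univ_five]
        push_cast
        ring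

theorem exists_perm_weighted_mul_prod_weighted_le (ha : 0 ≤ a) (has : a ≤ s) (e : Fin 5 → ℝ)
    (w : SpaceTime → ℝ≥0∞) (φ : Fin 5 → SpaceTime → ℝ≥0∞) (x : Fin 5 → SpaceTime) :
    ∃ ρ : Equiv.Perm (Fin 5),
      weighted (-(s + a)) p 1 w (∑ i, x i) * ∏ i, weighted s q (e i) (φ i) (x i) ≤
        ENNReal.ofReal (20 ^ (s + a)) *
          orderedIntegrand p q a (3 * s / 2) (e ∘ ρ) w (φ ∘ ρ) (x ∘ ρ) := by
  obtain ⟨ρ, hρ⟩ := exists_perm_bracketPow_sum_mul_prod_le ha has fun i => spatialFreq (x i)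
  refine ⟨ρ, ?_⟩
  simp only [orderedIntegrand, weighted, Function.comp_apply, Finset.prod_mul_distrib, neg_neg,
    Equiv.sum_comp ρ x, Equiv.prod_comp ρ fun i => modulated q (e i) (φ i) (x i), spatialFreq_sum]
  calc _ = bracketPow (s + a) (∑ i, spatialFreq (x i)) *
        (∏ i, bracketPow (-s) (spatialFreq (x i))) *
          (modulated p 1 w (∑ i, x i) * ∏ i, modulated q (e i) (φ i) (x i)) := by ring
    _ ≤ _ := mul_le_mul_left hρ _
    _ = _ := by ring

theorem sq_lintegral_weighted_mul_prod_weighted_le (hs : 1 / 3 < s) (hp : 1 / 2 < p) (hpq : p ≤ q)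
    (hq : 1 < q) (hpq' : p ≤ q') (hq' : 1 < q') (ha : 0 ≤ a) (has : a ≤ s)
    (hapq : 2 * (q' - p) + 2 * a ≤ 1) :
    ∃ C : ℝ≥0, ∀ e : Fin 5 → ℝ, (∀ i, e i ^ 2 = 1) → ∀ (w : SpaceTime → ℝ≥0∞)
      (φ : Fin 5 → SpaceTime → ℝ≥0∞), Measurable w → (∀ i, Measurable (φ i)) →
      (∫⁻ x : Fin 5 → SpaceTime, weighted (-(s + a)) p 1 w (∑ i, x i) *
        ∏ i, weighted s q (e i) (φ i) (x i)) ^ 2 ≤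
        C * ((∫⁻ ζ, w ζ ^ 2) * ∏ i, ∫⁻ ζ, φ i ζ ^ 2) := by
  obtain ⟨C, hC⟩ := sq_lintegral_orderedIntegrand_le hp hpq hq hpq' hq' ha hapq
    (show 1 / 2 < 3 * s / 2 by linarith)
  set K := (20 ^ (s + a) : ℝ).toNNReal
  set n := Fintype.card (Equiv.Perm (Fin 5))
  refine ⟨(K * n) ^ 2 * C, fun e he w φ hw hφ => ?_⟩
  set X := C * ((∫⁻ ζ, w ζ ^ 2) * ∏ i, ∫⁻ ζ, φ i ζ ^ 2)
  set T : Equiv.Perm (Fin 5) → (Fin 5 → SpaceTime) → ℝ≥0∞ := fun ρ x =>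
    orderedIntegrand p q a (3 * s / 2) (e ∘ ρ) w (φ ∘ ρ) (x ∘ ρ)
  have hTm : ∀ ρ, Measurable (T ρ) := fun ρ => by
    simp only [T, orderedIntegrand, Function.comp_apply]
    fun_prop
  have hTle : ∀ ρ, ∫⁻ x, T ρ x ≤ X ^ (1 / 2 : ℝ) := fun ρ => by
    refine le_rpow_half_of_sq_le ?_
    rw [lintegral_comp_perm ρ (orderedIntegrand p q a (3 * s / 2) (e ∘ ρ) w (φ ∘ ρ))]
    refine (hC (e ∘ ρ) (fun i => he _) w (φ ∘ ρ) hw fun i => hφ _).trans_eq ?_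
    simp only [Function.comp_apply, X, Equiv.prod_comp ρ fun i => ∫⁻ ζ, φ i ζ ^ 2]
  calc _ ≤ (∫⁻ x, K * ∑ ρ, T ρ x) ^ 2 := by
        refine pow_le_pow_left₀ zero_le (lintegral_mono fun x => ?_) 2
        obtain ⟨ρ, hρ⟩ := exists_perm_weighted_mul_prod_weighted_le ha has e w φ x
        refine hρ.trans (mul_le_mul_right ?_ _)
        exact Finset.single_le_sum (f := fun ρ => T ρ x) (fun _ _ => zero_le) (Finset.mem_univ ρ)
    _ = (K * ∑ ρ, ∫⁻ x, T ρ x) ^ 2 := by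
        rw [lintegral_const_mul _ (by fun_prop), lintegral_finsetSum _ fun ρ _ => hTm ρ]
    _ ≤ (K * ∑ _ρ : Equiv.Perm (Fin 5), X ^ (1 / 2 : ℝ)) ^ 2 := by
        gcongr with ρ
        exact hTle ρ
    _ = _ := by
        rw [Finset.sum_const, nsmul_eq_mul, Finset.card_univ, ← mul_assoc, mul_pow, rpow_half_sq]
        push_cast
        simp only [X, n, mul_assoc]

end Quintilinear

section FourierQuintic

variable {E : Type*} [NormedAddCommGroup E] [InnerProductSpace ℝ E] [FiniteDimensional ℝ E]
  [MeasurableSpace E] [BorelSpace E]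

theorem enorm_fourier_mul_le {p q : Lp ℂ 2 (volume : Measure E)} {f g : E → ℝ≥0∞}
    (hf : ∀ᵐ ζ, ‖(𝓕 p : Lp ℂ 2 (volume : Measure E)) ζ‖ₑ ≤ f ζ)
    (hg : ∀ᵐ ζ, ‖(𝓕 q : Lp ℂ 2 (volume : Measure E)) ζ‖ₑ ≤ g ζ) (ζ : E) :
    ‖𝓕 (fun x => p x * q x) ζ‖ₑ ≤ (f ⋆ₗ g) ζ := by
  rw [fourier_mul_Lp_two, lconvolution_def]
  refine (enorm_integral_le_lintegral_enorm _).trans (lintegral_mono_ae ?_)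
  have hsub := (Measure.measurePreserving_sub_left (volume : Measure E) ζ).quasiMeasurePreserving
  filter_upwards [hf, hsub.ae hg] with η hfη hgη
  rw [enorm_mul, neg_add_eq_sub]
  gcongr

theorem memLp_two_mul_of_lconvolution {p q : Lp ℂ 2 (volume : Measure E)} {f g : E → ℝ≥0∞}
    (hf : ∀ᵐ ζ, ‖(𝓕 p : Lp ℂ 2 (volume : Measure E)) ζ‖ₑ ≤ f ζ)
    (hg : ∀ᵐ ζ, ‖(𝓕 q : Lp ℂ 2 (volume : Measure E)) ζ‖ₑ ≤ g ζ)
    (hfg : ∫⁻ ζ, (f ⋆ₗ g) ζ ^ 2 < ∞) :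
    ∃ h : MemLp (fun x => p x * q x) 2 volume,
      ∀ᵐ ζ, ‖(𝓕 (h.toLp _) : Lp ℂ 2 (volume : Measure E)) ζ‖ₑ ≤ (f ⋆ₗ g) ζ := by
  have hle := enorm_fourier_mul_le hf hg
  have hint : Integrable (fun x => p x * q x) volume := (Lp.memLp p).integrable_mul (Lp.memLp q)
  have hmem : MemLp (𝓕 fun x => p x * q x) 2 volume := by
    refine ⟨(continuous_fourier_of_integrable hint).aestronglyMeasurable, ?_⟩
    have hsq : eLpNorm (𝓕 fun x => p x * q x) 2 volume ^ 2 < ∞ := by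
      rw [eLpNorm_two_sq]
      exact (lintegral_mono fun ζ => pow_le_pow_left₀ zero_le (hle ζ) 2).trans_lt hfg
    exact (ENNReal.pow_lt_top_iff.1 hsq).resolve_right two_ne_zero
  obtain ⟨h, hF⟩ := exists_memLp_two_of_memLp_two_fourier hint hmem
  exact ⟨h, hF.mono fun ζ hζ => hζ ▸ hle ζ⟩

theorem enorm_fourier_star_le {u : Lp ℂ 2 (volume : Measure E)} {f : E → ℝ≥0∞}
    (hf : ∀ᵐ ζ, ‖(𝓕 u : Lp ℂ 2 (volume : Measure E)) ζ‖ₑ ≤ f ζ) :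
    ∀ᵐ ζ, ‖(𝓕 (star u) : Lp ℂ 2 (volume : Measure E)) ζ‖ₑ ≤ f (-ζ) := by
  have hneg := (Measure.measurePreserving_neg (volume : Measure E)).quasiMeasurePreserving
  filter_upwards [fourier_star_Lp_two u, hneg.ae hf] with ζ hζ hle
  rwa [hζ, RCLike.enorm_conj]

theorem quintic_eq_mul (z : ℂ) :
    quintic z = z * z * (starRingEnd ℂ) z * (z * (starRingEnd ℂ) z) := by
  have hz : z * (starRingEnd ℂ) z = (‖z‖ : ℂ) ^ 2 := Complex.mul_conj' z
  rw [mul_assoc z z, hz, quintic]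
  ring

/-- The fivefold convolution which corresponds to the product `|u|⁴ u = (u u ū)(u ū)`, the
frequencies of `ū` being reflected. -/
def quinticConvolution (f : E → ℝ≥0∞) : E → ℝ≥0∞ :=
  ((f ⋆ₗ f) ⋆ₗ fun x => f (-x)) ⋆ₗ (f ⋆ₗ fun x => f (-x))

theorem integrable_quintic_and_enorm_fourier_le (u : Lp ℂ 2 (volume : Measure E))
    {f : E → ℝ≥0∞} (hf : ∀ᵐ ζ, ‖(𝓕 u : Lp ℂ 2 (volume : Measure E)) ζ‖ₑ ≤ f ζ)
    (huu : ∫⁻ ζ, (f ⋆ₗ f) ζ ^ 2 < ∞) (hu_conj : ∫⁻ ζ, (f ⋆ₗ fun x => f (-x)) ζ ^ 2 < ∞)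
    (huu_conj : ∫⁻ ζ, ((f ⋆ₗ f) ⋆ₗ fun x => f (-x)) ζ ^ 2 < ∞) :
    Integrable (fun x => quintic (u x)) volume ∧
      ∀ ζ, ‖𝓕 (fun x => quintic (u x)) ζ‖ₑ ≤ quinticConvolution f ζ := by
  have hf' := enorm_fourier_star_le hf
  obtain ⟨hP, hPle⟩ := memLp_two_mul_of_lconvolution hf hf huu
  obtain ⟨hQ, hQle⟩ := memLp_two_mul_of_lconvolution hPle hf' huu_conj
  obtain ⟨hR, hRle⟩ := memLp_two_mul_of_lconvolution hf hf' hu_conj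
  have hae : (fun x => hQ.toLp _ x * hR.toLp _ x) =ᵐ[volume] fun x => quintic (u x) := by
    filter_upwards [hP.coeFn_toLp, hQ.coeFn_toLp, hR.coeFn_toLp, Lp.coeFn_star u]
      with x hPx hQx hRx hu
    rw [hQx, hRx, hPx, hu, quintic_eq_mul, Pi.star_apply, starRingEnd_apply]
  refine ⟨((Lp.memLp _).integrable_mul (Lp.memLp _)).congr hae, fun ζ => ?_⟩
  rw [← Real.fourier_congr_ae hae]
  exact enorm_fourier_mul_le hQle hRle ζ

end FourierQuintic

section QuinticEstimate

theorem mul_mul_le_add_pow_three (x y z : ℝ≥0∞) : x * y * z ≤ x ^ 3 + y ^ 3 + z ^ 3 := by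
  set m := max (max x y) z
  have hm : m ^ 3 ≤ x ^ 3 + y ^ 3 + z ^ 3 := by
    rcases max_choice (max x y) z with h | h
    · rcases max_choice x y with h' | h'
      · exact (by rw [← h', ← h] : m ^ 3 = x ^ 3).trans_le (le_self_add.trans le_self_add)
      · exact (by rw [← h', ← h] : m ^ 3 = y ^ 3).trans_le (le_add_self.trans le_self_add)
    · exact (by rw [← h] : m ^ 3 = z ^ 3).trans_le le_add_self
  calc x * y * z ≤ m * m * m := by
        gcongr
        · exact (le_max_left x y).trans (le_max_left _ _)
        · exact (le_max_right x y).trans (le_max_left _ _)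
        · exact le_max_right _ _
    _ = m ^ 3 := by ring
    _ ≤ _ := hm

theorem bracketPow_neg_pow_three (s y : ℝ) : bracketPow (-s) y ^ 3 = bracketPow (-(3 * s)) y := by
  rw [pow_succ, bracketPow_sq, bracketPow_mul]
  ring_nf

variable {s q : ℝ} {e₁ e₂ e₃ : ℝ} {φ₁ φ₂ φ₃ : SpaceTime → ℝ≥0∞}

theorem weighted_mul_mul_le (s q e₁ e₂ e₃ : ℝ) (φ₁ φ₂ φ₃ : SpaceTime → ℝ≥0∞)
    (x y z : SpaceTime) :
    weighted s q e₁ φ₁ x * weighted s q e₂ φ₂ y * weighted s q e₃ φ₃ z ≤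
      weighted (3 * s) q e₁ φ₁ x * modulated q e₂ φ₂ y * modulated q e₃ φ₃ z +
      modulated q e₁ φ₁ x * weighted (3 * s) q e₂ φ₂ y * modulated q e₃ φ₃ z +
      modulated q e₁ φ₁ x * modulated q e₂ φ₂ y * weighted (3 * s) q e₃ φ₃ z := by
  simp only [weighted, ← bracketPow_neg_pow_three]
  set X := modulated q e₁ φ₁ x
  set Y := modulated q e₂ φ₂ y
  set Z := modulated q e₃ φ₃ z
  calc _ = (bracketPow (-s) (spatialFreq x) * bracketPow (-s) (spatialFreq y) *
        bracketPow (-s) (spatialFreq z)) * (X * Y * Z) := by ring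
    _ ≤ _ := mul_le_mul_left (mul_mul_le_add_pow_three _ _ _) _
    _ = _ := by ring

theorem lconvolution_weighted_three_le (s q e₁ e₂ e₃ : ℝ) (h₁ : Measurable φ₁)
    (h₂ : Measurable φ₂) (h₃ : Measurable φ₃) (ζ : SpaceTime) :
    ((weighted s q e₁ φ₁ ⋆ₗ weighted s q e₂ φ₂) ⋆ₗ weighted s q e₃ φ₃) ζ ≤
      (weighted (3 * s) q e₁ φ₁ ⋆ₗ (modulated q e₂ φ₂ ⋆ₗ modulated q e₃ φ₃)) ζ +
      (weighted (3 * s) q e₂ φ₂ ⋆ₗ (modulated q e₁ φ₁ ⋆ₗ modulated q e₃ φ₃)) ζ +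
      (weighted (3 * s) q e₃ φ₃ ⋆ₗ (modulated q e₁ φ₁ ⋆ₗ modulated q e₂ φ₂)) ζ := by
  rw [lconvolution_assoc (by fun_prop) (by fun_prop) (by fun_prop),
    lconvolution_assoc (by fun_prop) (by fun_prop) (by fun_prop),
    lconvolution_comm (f := weighted (3 * s) q e₂ φ₂),
    lconvolution_comm (f := weighted (3 * s) q e₃ φ₃)]
  simp only [lconvolution_lconvolution_apply (measurable_weighted _ _ _ h₁)
      (measurable_weighted _ _ _ h₂),
    lconvolution_lconvolution_apply (measurable_weighted _ _ _ h₁) (measurable_modulated _ _ h₂),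
    lconvolution_lconvolution_apply (measurable_modulated _ _ h₁) (measurable_weighted _ _ _ h₂),
    lconvolution_lconvolution_apply (measurable_modulated _ _ h₁) (measurable_modulated _ _ h₂)]
  rw [← lintegral_add_left (by fun_prop), ← lintegral_add_left (by fun_prop)]
  refine lintegral_mono fun y => ?_
  rw [← lintegral_add_left (by fun_prop), ← lintegral_add_left (by fun_prop)]
  exact lintegral_mono fun x => weighted_mul_mul_le _ _ _ _ _ _ _ _ _ _ _

theorem lintegral_sq_lconvolution_weighted_lt_top (hs : 0 ≤ s) (hq : 1 < q) (he₁ : e₁ ^ 2 = 1)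
    (he₂ : e₂ ^ 2 = 1) (h₁ : Measurable φ₁) (h₂ : Measurable φ₂) (hφ₁ : ∫⁻ ζ, φ₁ ζ ^ 2 < ∞)
    (hφ₂ : ∫⁻ ζ, φ₂ ζ ^ 2 < ∞) :
    ∫⁻ ζ, (weighted s q e₁ φ₁ ⋆ₗ weighted s q e₂ φ₂) ζ ^ 2 < ∞ := by
  obtain ⟨C, hC⟩ := lintegral_sq_lconvolution_modulated_le (by linarith : 1 / 2 < q) le_rfl hq
  refine lt_of_le_of_lt (lintegral_mono fun ζ => ?_) ((hC e₁ e₂ he₁ he₂ φ₁ φ₂ h₁ h₂).trans_lt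
    (ENNReal.mul_lt_top (ENNReal.mul_lt_top ENNReal.coe_lt_top hφ₁) hφ₂))
  simp only [lconvolution_def]
  gcongr
  · exact weighted_le_modulated hs _ _ _ _
  · exact weighted_le_modulated hs _ _ _ _

theorem lintegral_sq_lconvolution_weighted_modulated_lt_top {r : ℝ} (hr : 1 / 2 < r) (hq : 1 < q)
    (he₁ : e₁ ^ 2 = 1) (he₂ : e₂ ^ 2 = 1) (he₃ : e₃ ^ 2 = 1)
    (h₁ : Measurable φ₁) (h₂ : Measurable φ₂) (h₃ : Measurable φ₃)
    (hφ₁ : ∫⁻ ζ, φ₁ ζ ^ 2 < ∞) (hφ₂ : ∫⁻ ζ, φ₂ ζ ^ 2 < ∞) (hφ₃ : ∫⁻ ζ, φ₃ ζ ^ 2 < ∞) :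
    ∫⁻ ζ, (weighted r q e₁ φ₁ ⋆ₗ (modulated q e₂ φ₂ ⋆ₗ modulated q e₃ φ₃)) ζ ^ 2 < ∞ := by
  obtain ⟨C, hC⟩ := sq_lintegral_weighted_le hr hq
  refine (lintegral_sq_lconvolution_le (measurable_weighted _ _ _ h₁)
    (measurable_lconvolution _ (by fun_prop) (by fun_prop))).trans_lt (ENNReal.mul_lt_top ?_ ?_)
  · exact (hC e₁ he₁ φ₁ h₁).trans_lt (ENNReal.mul_lt_top ENNReal.coe_lt_top hφ₁)
  · simp only [← weighted_zero]
    exact lintegral_sq_lconvolution_weighted_lt_top le_rfl hq he₂ he₃ h₂ h₃ hφ₂ hφ₃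

theorem lintegral_sq_lconvolution_weighted_three_lt_top (hs : 1 / 6 < s) (hq : 1 < q)
    (he₁ : e₁ ^ 2 = 1) (he₂ : e₂ ^ 2 = 1) (he₃ : e₃ ^ 2 = 1)
    (h₁ : Measurable φ₁) (h₂ : Measurable φ₂) (h₃ : Measurable φ₃)
    (hφ₁ : ∫⁻ ζ, φ₁ ζ ^ 2 < ∞) (hφ₂ : ∫⁻ ζ, φ₂ ζ ^ 2 < ∞) (hφ₃ : ∫⁻ ζ, φ₃ ζ ^ 2 < ∞) :
    ∫⁻ ζ, ((weighted s q e₁ φ₁ ⋆ₗ weighted s q e₂ φ₂) ⋆ₗ weighted s q e₃ φ₃) ζ ^ 2 < ∞ := by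
  have hr : 1 / 2 < 3 * s := by linarith
  have hmeas : ∀ {e e' e'' : ℝ} {φ φ' φ'' : SpaceTime → ℝ≥0∞}, Measurable φ → Measurable φ' →
      Measurable φ'' →
      Measurable (weighted (3 * s) q e φ ⋆ₗ (modulated q e' φ' ⋆ₗ modulated q e'' φ'')) :=
    fun h h' h'' => measurable_lconvolution _ (measurable_weighted _ _ _ h)
      (measurable_lconvolution _ (measurable_modulated _ _ h') (measurable_modulated _ _ h''))
  refine lt_of_le_of_lt (lintegral_mono fun ζ => pow_le_pow_left₀ zero_le
    (lconvolution_weighted_three_le s q e₁ e₂ e₃ h₁ h₂ h₃ ζ) 2) ?_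
  refine lintegral_sq_add_lt_top ((hmeas h₁ h₂ h₃).add (hmeas h₂ h₁ h₃))
    (lintegral_sq_add_lt_top (hmeas h₁ h₂ h₃) ?_ ?_) ?_
  · exact lintegral_sq_lconvolution_weighted_modulated_lt_top hr hq he₁ he₂ he₃ h₁ h₂ h₃ hφ₁ hφ₂ hφ₃
  · exact lintegral_sq_lconvolution_weighted_modulated_lt_top hr hq he₂ he₁ he₃ h₂ h₁ h₃ hφ₂ hφ₁ hφ₃
  · exact lintegral_sq_lconvolution_weighted_modulated_lt_top hr hq he₃ he₁ he₂ h₃ h₁ h₂ hφ₃ hφ₁ hφ₂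

theorem lintegral_mul_five_lconvolution {G : Type*} [MeasureSpace G] [AddCommGroup G]
    [MeasurableAdd₂ G] [MeasurableNeg G] [SigmaFinite (volume : Measure G)]
    [(volume : Measure G).IsAddLeftInvariant] {w : G → ℝ≥0∞} {F : Fin 5 → G → ℝ≥0∞}
    (hw : Measurable w) (hF : ∀ i, Measurable (F i)) :
    ∫⁻ ζ, w ζ * (((F 0 ⋆ₗ F 1) ⋆ₗ F 2) ⋆ₗ (F 3 ⋆ₗ F 4)) ζ =
      ∫⁻ x : Fin 5 → G, w (∑ i, x i) * ∏ i, F i (x i) := by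
  have hc : ∀ {f g : G → ℝ≥0∞}, Measurable f → Measurable g → Measurable (f ⋆ₗ g) :=
    measurable_lconvolution _
  have h₃₄ := hc (hF 3) (hF 4)
  have h₂₃₄ := hc (hF 2) h₃₄
  have h₄ := hF 4
  rw [← lconvolution_assoc (hc (hF 0) (hF 1)) (hF 2) h₃₄, ← lconvolution_assoc (hF 0) (hF 1) h₂₃₄,
    lintegral_fin_five_mul_prod (H := fun z _ => w z) (by fun_prop) hF,
    lintegral_mul_lconvolution hw (hF 0) (hc (hF 1) h₂₃₄)]
  simp only [mul_comm _ (w _)]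
  refine lintegral_congr fun x₀ => ?_
  rw [lintegral_mul_lconvolution (w := fun y => w (x₀ + y)) (by fun_prop) (hF 1) h₂₃₄]
  simp only [mul_comm _ (w _)]
  congr 1
  refine lintegral_congr fun x₁ => ?_
  rw [lintegral_mul_lconvolution (w := fun y => w (x₀ + (x₁ + y))) (by fun_prop) (hF 2) h₃₄]
  simp only [mul_comm _ (w _)]
  congr 1
  refine lintegral_congr fun x₂ => ?_
  rw [lintegral_mul_lconvolution (w := fun y => w (x₀ + (x₁ + (x₂ + y)))) (by fun_prop) (hF 3) h₄]
  simp only [mul_comm _ (w _), add_assoc]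

theorem lintegral_sq_five_lconvolution_weighted_le {p q' a : ℝ} (hs : 1 / 3 < s) (hp : 1 / 2 < p)
    (hpq : p ≤ q) (hq : 1 < q) (hpq' : p ≤ q') (hq' : 1 < q') (ha : 0 ≤ a) (has : a ≤ s)
    (hapq : 2 * (q' - p) + 2 * a ≤ 1) :
    ∃ C : ℝ≥0, ∀ e : Fin 5 → ℝ, (∀ i, e i ^ 2 = 1) → ∀ φ : Fin 5 → SpaceTime → ℝ≥0∞,
      (∀ i, Measurable (φ i)) →
      ∫⁻ ζ, weighted (-(s + a)) p 1
        (((weighted s q (e 0) (φ 0) ⋆ₗ weighted s q (e 1) (φ 1)) ⋆ₗ weighted s q (e 2) (φ 2)) ⋆ₗ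
          (weighted s q (e 3) (φ 3) ⋆ₗ weighted s q (e 4) (φ 4))) ζ ^ 2 ≤
        C * ∏ i, ∫⁻ ζ, φ i ζ ^ 2 := by
  obtain ⟨C, hC⟩ := sq_lintegral_weighted_mul_prod_weighted_le hs hp hpq hq hpq' hq' ha has hapq
  refine ⟨C, fun e he φ hφ => lintegral_sq_le_of_forall_sq_lintegral_mul_le fun w hw => ?_⟩
  have hduality := hC e he w φ hw hφ
  rw [← lintegral_mul_five_lconvolution (F := fun i => weighted s q (e i) (φ i)) (by fun_prop)
    fun i => measurable_weighted _ _ _ (hφ i), mul_comm (∫⁻ ζ, w ζ ^ 2),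
    ← mul_assoc] at hduality
  refine le_trans (le_of_eq (congrArg (· ^ 2) (lintegral_congr fun ζ => ?_))) hduality
  simp only [weighted, modulated]
  ring

theorem lintegral_sq_weighted_quinticConvolution_le {p q' a : ℝ} (hs : 1 / 3 < s) (hp : 1 / 2 < p)
    (hpq : p ≤ q) (hq : 1 < q) (hpq' : p ≤ q') (hq' : 1 < q') (ha : 0 ≤ a) (has : a ≤ s)
    (hapq : 2 * (q' - p) + 2 * a ≤ 1) :
    ∃ C : ℝ≥0, ∀ φ : SpaceTime → ℝ≥0∞, Measurable φ →
      ∫⁻ ζ, weighted (-(s + a)) p 1 (quinticConvolution (weighted s q 1 φ)) ζ ^ 2 ≤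
        C * (∫⁻ ζ, φ ζ ^ 2) ^ 5 := by
  obtain ⟨C, hC⟩ := lintegral_sq_five_lconvolution_weighted_le hs hp hpq hq hpq' hq' ha has hapq
  refine ⟨C, fun φ hφ => ?_⟩
  set ψ : SpaceTime → ℝ≥0∞ := fun x => φ (-x)
  have hψ : ∫⁻ ζ, ψ ζ ^ 2 = ∫⁻ ζ, φ ζ ^ 2 := lintegral_neg_eq_self fun ζ => φ ζ ^ 2
  set e : Fin 5 → ℝ := ![1, 1, -1, 1, -1]
  set Φ : Fin 5 → SpaceTime → ℝ≥0∞ := ![φ, φ, ψ, φ, ψ]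
  have he : ∀ i, e i ^ 2 = 1 := by simp [e, Fin.forall_fin_succ]
  have hψm : Measurable ψ := by fun_prop
  have hΦ : ∀ i, Measurable (Φ i) := by simp [Φ, Fin.forall_fin_succ, hφ, hψm]
  have h := hC e he Φ hΦ
  have hprod : ∏ i, ∫⁻ ζ, Φ i ζ ^ 2 = (∫⁻ ζ, φ ζ ^ 2) ^ 5 := by
    simp only [Fin.prod_univ_five, Φ, Matrix.cons_val, hψ]
    ring
  rw [hprod] at h
  simp only [quinticConvolution, weighted_neg]
  exact h

end QuinticEstimate

section QuinticBourgain

/-- The weight `⟨ω + k²⟩^b ⟨k⟩^s` of the Bourgain norm. -/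
def bourgainWeight (s b : ℝ) (ζ : SpaceTime) : ℝ :=
  japaneseBracket (2 * Real.pi * ζ.fst + (2 * Real.pi * ζ.snd) ^ 2) ^ b *
    japaneseBracket (2 * Real.pi * ζ.snd) ^ s

theorem enorm_bourgainWeight (s b : ℝ) (ζ : SpaceTime) :
    ‖(bourgainWeight s b ζ : ℂ)‖ₑ =
      bracketPow s (spatialFreq ζ) * bracketPow b (modulation 1 ζ) := by
  rw [bourgainWeight, Complex.ofReal_mul, enorm_mul, ← bracketPow_eq_enorm,
    ← bracketPow_eq_enorm, modulation, spatialFreq, one_mul, mul_comm]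

theorem measurable_enorm_bourgainWeight (s b : ℝ) :
    Measurable fun ζ => ‖(bourgainWeight s b ζ : ℂ)‖ₑ := by
  simp only [enorm_bourgainWeight]
  fun_prop

theorem enorm_bourgainWeight_mul_eq_weighted (s p : ℝ) (f : SpaceTime → ℂ) (ζ : SpaceTime) :
    ‖(bourgainWeight s (-p / 2) ζ : ℂ) * f ζ‖ₑ = weighted (-s) p 1 (fun ζ => ‖f ζ‖ₑ) ζ := by
  rw [enorm_mul, enorm_bourgainWeight, weighted, modulated, neg_neg, mul_assoc]

theorem enorm_bourgainWeight_mono {s s' : ℝ} (h : s ≤ s') (b : ℝ) (ζ : SpaceTime) :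
    ‖(bourgainWeight s b ζ : ℂ)‖ₑ ≤ ‖(bourgainWeight s' b ζ : ℂ)‖ₑ := by
  rw [enorm_bourgainWeight, enorm_bourgainWeight]
  gcongr
  exact bracketPow_mono h _

/-- The modulus of `⟨ω + k²⟩^b ⟨k⟩^s û`, whose `L²` norm is the Bourgain norm of `u`. -/
def bourgainProfile (s b : ℝ) (u : Lp ℂ 2 (volume : Measure SpaceTime)) (ζ : SpaceTime) : ℝ≥0∞ :=
  ‖(bourgainWeight s b ζ : ℂ) * (𝓕 u : Lp ℂ 2 (volume : Measure SpaceTime)) ζ‖ₑ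

variable (s b : ℝ) (u : Lp ℂ 2 (volume : Measure SpaceTime))

theorem measurable_bourgainProfile : Measurable (bourgainProfile s b u) := by
  unfold bourgainProfile
  simp only [enorm_mul]
  exact (measurable_enorm_bourgainWeight s b).mul (Lp.stronglyMeasurable _).measurable.enorm

theorem lintegral_sq_bourgainProfile :
    ∫⁻ ζ, bourgainProfile s b u ζ ^ 2 = bourgainNorm s b u ^ 2 := by
  rw [bourgainNorm, weightedFourierNorm_Lp_two, eLpNorm_two_sq]
  rfl

theorem enorm_fourier_eq_weighted_bourgainProfile (ζ : SpaceTime) :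
    ‖(𝓕 u : Lp ℂ 2 (volume : Measure SpaceTime)) ζ‖ₑ =
      weighted s (2 * b) 1 (bourgainProfile s b u) ζ := by
  set z := ‖(𝓕 u : Lp ℂ 2 (volume : Measure SpaceTime)) ζ‖ₑ with hz
  rw [weighted, modulated, bourgainProfile, enorm_mul, enorm_bourgainWeight, ← hz,
    show -(2 * b) / 2 = -b by ring]
  calc z = (bracketPow (-s) (spatialFreq ζ) * bracketPow s (spatialFreq ζ)) *
        ((bracketPow (-b) (modulation 1 ζ) * bracketPow b (modulation 1 ζ)) * z) := by
        rw [bracketPow_neg_mul_cancel, bracketPow_neg_mul_cancel, one_mul, one_mul]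
    _ = _ := by ring

variable {s b u}

theorem integrable_quintic_and_enorm_fourier_le_of_bourgainNorm (hs : 1 / 6 < s) (hb : 1 / 2 < b)
    (hu : bourgainNorm s b u ≠ ∞) :
    Integrable (fun z => quintic (u z)) volume ∧
      ∀ ζ, ‖𝓕 (fun z => quintic (u z)) ζ‖ₑ ≤
        quinticConvolution (weighted s (2 * b) 1 (bourgainProfile s b u)) ζ := by
  have hs₀ : 0 ≤ s := by linarith
  have hq : 1 < 2 * b := by linarith
  have he : (1 : ℝ) ^ 2 = 1 := one_pow 2
  have he' : (-1 : ℝ) ^ 2 = 1 := by norm_num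
  have hm := measurable_bourgainProfile s b u
  have hφ : ∫⁻ ζ, bourgainProfile s b u ζ ^ 2 < ∞ := by
    rw [lintegral_sq_bourgainProfile]
    exact ENNReal.pow_lt_top hu.lt_top
  have hm' : Measurable fun ζ => bourgainProfile s b u (-ζ) := hm.comp measurable_neg
  have hφ' : ∫⁻ ζ, bourgainProfile s b u (-ζ) ^ 2 < ∞ := by
    rwa [lintegral_neg_eq_self fun ζ => bourgainProfile s b u ζ ^ 2]
  refine integrable_quintic_and_enorm_fourier_le u
    (Eventually.of_forall fun ζ => (enorm_fourier_eq_weighted_bourgainProfile s b u ζ).le) ?_ ?_ ?_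
  · exact (lintegral_sq_lconvolution_weighted_lt_top hs₀ hq he he hm hm hφ hφ)
  · simp only [weighted_neg]
    exact (lintegral_sq_lconvolution_weighted_lt_top hs₀ hq he he' hm hm' hφ hφ')
  · simp only [weighted_neg]
    exact (lintegral_sq_lconvolution_weighted_three_lt_top hs hq he he he' hm hm hm'
      hφ hφ hφ')

theorem eLpNorm_bourgainWeight_mul_fourier_quintic_le_of_nonneg {a δ ε : ℝ} (hs : 1 / 3 < s)
    (ha : 0 ≤ a) (has : a ≤ s) (hδ : 0 < δ) (haδ : 2 * a + 6 * δ ≤ 1) (hε : 0 < ε) :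
    ∃ C : ℝ≥0, ∀ u : Lp ℂ 2 (volume : Measure SpaceTime), bourgainNorm s (1 / 2 + ε) u ≠ ∞ →
      eLpNorm (fun ζ => (bourgainWeight (s + a) (-1 / 2 + δ) ζ : ℂ) *
        𝓕 (fun z => quintic (u z)) ζ) 2 volume ≤ C * bourgainNorm s (1 / 2 + ε) u ^ 5 := by
  obtain ⟨C, hC⟩ := lintegral_sq_weighted_quinticConvolution_le (p := 1 - 2 * δ)
    (q := 2 * (1 / 2 + ε)) (q' := 1 + δ) hs (by linarith) (by linarith) (by linarith)
    (by linarith) (by linarith) ha has (by linarith)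
  refine ⟨NNReal.sqrt C, fun u hu => ?_⟩
  have hle := (integrable_quintic_and_enorm_fourier_le_of_bourgainNorm (by linarith) (by linarith)
    hu).2
  have hp : -1 / 2 + δ = -(1 - 2 * δ) / 2 := by ring
  rw [← ENNReal.pow_le_pow_left_iff two_ne_zero, eLpNorm_two_sq]
  calc _ = ∫⁻ ζ, weighted (-(s + a)) (1 - 2 * δ) 1
          (fun ζ => ‖𝓕 (fun z => quintic (u z)) ζ‖ₑ) ζ ^ 2 := by
        simp only [hp, enorm_bourgainWeight_mul_eq_weighted]
    _ ≤ ∫⁻ ζ, weighted (-(s + a)) (1 - 2 * δ) 1 (quinticConvolution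
          (weighted s (2 * (1 / 2 + ε)) 1 (bourgainProfile s (1 / 2 + ε) u))) ζ ^ 2 := by
        unfold weighted modulated
        gcongr with ζ
        exact hle ζ
    _ ≤ C * (∫⁻ ζ, bourgainProfile s (1 / 2 + ε) u ζ ^ 2) ^ 5 :=
        hC _ (measurable_bourgainProfile _ _ _)
    _ = _ := by
        rw [lintegral_sq_bourgainProfile, mul_pow, ← ENNReal.coe_pow, NNReal.sq_sqrt]
        ring

theorem exists_eLpNorm_bourgainWeight_mul_fourier_quintic_le {a : ℝ} (hs : 1 / 3 < s)
    (ha : a < min (3 * s - 1) (1 / 2)) :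
    ∃ δ₀ : ℝ, 0 < δ₀ ∧ ∀ δ : ℝ, 0 < δ → δ < δ₀ → ∀ ε : ℝ, 0 < ε → ∃ C : ℝ≥0,
      ∀ u : Lp ℂ 2 (volume : Measure SpaceTime), bourgainNorm s (1 / 2 + ε) u ≠ ∞ →
        eLpNorm (fun ζ => (bourgainWeight (s + a) (-1 / 2 + δ) ζ : ℂ) *
          𝓕 (fun z => quintic (u z)) ζ) 2 volume ≤ C * bourgainNorm s (1 / 2 + ε) u ^ 5 := by
  obtain ⟨ha₁, ha₂⟩ := lt_min_iff.1 ha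
  set a' := max a 0
  have ha' : a' < 1 / 2 := max_lt ha₂ (by norm_num)
  have has : a' ≤ s := by
    have : a' < 3 * s - 1 := max_lt ha₁ (by linarith)
    rcases le_total s (1 / 2) <;> linarith
  refine ⟨(1 - 2 * a') / 6, by linarith, fun δ hδ hδ' ε hε => ?_⟩
  obtain ⟨C, hC⟩ := eLpNorm_bourgainWeight_mul_fourier_quintic_le_of_nonneg hs (le_max_right a 0)
    has hδ (by linarith) hε
  refine ⟨C, fun u hu => (eLpNorm_mono_enorm fun ζ => ?_).trans (hC u hu)⟩
  rw [enorm_mul, enorm_mul]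
  gcongr
  exact enorm_bourgainWeight_mono (by linarith [le_max_left a 0]) _ ζ

theorem bourgainNorm_quintic_le {a : ℝ} (hs : 1 / 3 < s) (ha : a < min (3 * s - 1) (1 / 2)) :
    ∃ δ₀ : ℝ, 0 < δ₀ ∧ ∀ δ : ℝ, 0 < δ → δ < δ₀ → ∀ ε : ℝ, 0 < ε → ∃ C : ℝ≥0,
      ∀ u : Lp ℂ 2 (volume : Measure SpaceTime), bourgainNorm s (1 / 2 + ε) u ≠ ∞ →
        ∃ hu : MemLp (fun z => quintic (u z)) 1 volume,
          bourgainNorm (s + a) (-1 / 2 + δ) (hu.toLp _) ≤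
            C * bourgainNorm s (1 / 2 + ε) u ^ 5 := by
  obtain ⟨δ₀, hδ₀, h⟩ := exists_eLpNorm_bourgainWeight_mul_fourier_quintic_le hs ha
  refine ⟨δ₀, hδ₀, fun δ hδ hδ' ε hε => ?_⟩
  obtain ⟨C, hC⟩ := h δ hδ hδ' ε hε
  refine ⟨C, fun u hu => ?_⟩
  have hint := (integrable_quintic_and_enorm_fourier_le_of_bourgainNorm (by linarith)
    (by linarith) hu).1
  exact ⟨memLp_one_iff_integrable.2 hint, (weightedFourierNorm_toLp_one_le _ _).trans (hC u hu)⟩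

end QuinticBourgain

section TimeIntegral

open scoped Convolution

theorem enorm_le_lintegral_enorm_fourier {V E : Type*} [NormedAddCommGroup V]
    [InnerProductSpace ℝ V] [FiniteDimensional ℝ V] [MeasurableSpace V] [BorelSpace V]
    [NormedAddCommGroup E] [NormedSpace ℂ E] [CompleteSpace E] {f : V → E}
    (hf : Integrable f volume) {x : V} (hfx : ContinuousAt f x) : ‖f x‖ₑ ≤ ∫⁻ ξ, ‖𝓕 f ξ‖ₑ := by
  rcases eq_or_ne (∫⁻ ξ, ‖𝓕 f ξ‖ₑ) ∞ with htop | htop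
  · rw [htop]
    exact le_top
  · have hf' : Integrable (𝓕 f) volume :=
      ⟨(continuous_fourier_of_integrable hf).aestronglyMeasurable, htop.lt_top⟩
    rw [← hf.fourierInv_fourier_eq hf' hfx, Real.fourierInv_eq]
    refine (enorm_integral_le_lintegral_enorm _).trans_eq (lintegral_congr fun ξ => ?_)
    rw [← ofReal_norm, Circle.norm_smul, ofReal_norm]

theorem integrable_indicator_Ioc (a b : ℝ) :
    Integrable ((Set.Ioc a b).indicator fun _ => (1 : ℂ)) volume :=
  (integrable_indicator_iff measurableSet_Ioc).2 (integrableOn_const (by simp))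

variable {t : ℝ}

theorem convolution_indicator_Ioc (ht : 0 ≤ t) (g : ℝ → ℂ) (r : ℝ) :
    ((Set.Ioc (-t) 0).indicator (fun _ => (1 : ℂ)) ⋆[ContinuousLinearMap.mul ℂ ℂ] g) r =
      ∫ y in r..r + t, g y := by
  have h : ∀ y, (ContinuousLinearMap.mul ℂ ℂ) ((Set.Ioc (-t) 0).indicator (fun _ => (1 : ℂ)) y)
      (g (r - y)) = (Set.Ioc (-t) 0).indicator (fun y => g (r - y)) y := fun y => by
    by_cases hy : y ∈ Set.Ioc (-t) 0 <;> simp [hy]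
  simp only [convolution_def, h]
  rw [integral_indicator measurableSet_Ioc, ← intervalIntegral.integral_of_le (by linarith),
    intervalIntegral.integral_comp_sub_left, sub_zero, sub_neg_eq_add]

theorem continuous_convolution_indicator_Ioc (ht : 0 ≤ t) {g : ℝ → ℂ} (hg : Integrable g volume) :
    Continuous
      ((Set.Ioc (-t) 0).indicator (fun _ => (1 : ℂ)) ⋆[ContinuousLinearMap.mul ℂ ℂ] g) := by
  have hprim : Continuous fun r => ∫ y in (0 : ℝ)..r, g y :=
    intervalIntegral.continuous_primitive (fun _ _ => hg.intervalIntegrable) 0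
  have heq : ((Set.Ioc (-t) 0).indicator (fun _ => (1 : ℂ)) ⋆[ContinuousLinearMap.mul ℂ ℂ] g) =
      fun r => (∫ y in (0 : ℝ)..(r + t), g y) - ∫ y in (0 : ℝ)..r, g y := by
    funext r
    rw [convolution_indicator_Ioc ht, intervalIntegral.integral_interval_sub_left
      hg.intervalIntegrable hg.intervalIntegrable]
  rw [heq]
  fun_prop

theorem fourier_indicator_Ioc (ht : 0 ≤ t) (σ : ℝ) :
    𝓕 ((Set.Ioc (-t) 0).indicator fun _ => (1 : ℂ)) σ =
      ∫ x in (-t)..0, Complex.exp (((-(2 * Real.pi * σ) : ℝ) : ℂ) * Complex.I * x) := by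
  rw [Real.fourier_real_eq_integral_exp_smul, intervalIntegral.integral_of_le (by linarith),
    ← integral_indicator measurableSet_Ioc]
  refine integral_congr_ae (Eventually.of_forall fun x => ?_)
  by_cases hx : x ∈ Set.Ioc (-t) 0
  · simp only [Set.indicator_of_mem hx, smul_eq_mul, mul_one]
    congr 1
    push_cast
    ring
  · simp [hx]

theorem norm_exp_ofReal_mul_I_mul (c x : ℝ) : ‖Complex.exp ((c : ℂ) * Complex.I * x)‖ = 1 := by
  rw [mul_right_comm, ← Complex.ofReal_mul, Complex.norm_exp_ofReal_mul_I]

theorem norm_fourier_indicator_Ioc_le (ht : 0 ≤ t) (σ : ℝ) :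
    ‖𝓕 ((Set.Ioc (-t) 0).indicator fun _ => (1 : ℂ)) σ‖ ≤ t := by
  rw [fourier_indicator_Ioc ht]
  refine (intervalIntegral.norm_integral_le_of_norm_le_const fun x _ =>
    (norm_exp_ofReal_mul_I_mul _ x).le).trans_eq ?_
  rw [one_mul, sub_neg_eq_add, zero_add, abs_of_nonneg ht]

theorem norm_fourier_indicator_Ioc_mul_abs_le (ht : 0 ≤ t) (σ : ℝ) :
    ‖𝓕 ((Set.Ioc (-t) 0).indicator fun _ => (1 : ℂ)) σ‖ * |2 * Real.pi * σ| ≤ 2 := by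
  rcases eq_or_ne (2 * Real.pi * σ) 0 with h₀ | h₀
  · rw [h₀]
    simp
  · have hc : ((-(2 * Real.pi * σ) : ℝ) : ℂ) * Complex.I ≠ 0 :=
      mul_ne_zero (by exact_mod_cast neg_ne_zero.2 h₀) Complex.I_ne_zero
    rw [fourier_indicator_Ioc ht, integral_exp_mul_complex hc, norm_div, norm_mul, Complex.norm_I,
      mul_one, Complex.norm_real, norm_neg, Real.norm_eq_abs,
      div_mul_cancel₀ _ (abs_ne_zero.2 h₀)]
    refine (norm_sub_le _ _).trans_eq ?_
    rw [norm_exp_ofReal_mul_I_mul, norm_exp_ofReal_mul_I_mul]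
    norm_num

theorem enorm_fourier_indicator_Ioc_le (ht : 0 ≤ t) (σ : ℝ) :
    ‖𝓕 ((Set.Ioc (-t) 0).indicator fun _ => (1 : ℂ)) σ‖ₑ ≤
      ENNReal.ofReal (t + 2) * bracketPow (-1) (2 * Real.pi * σ) := by
  set K := 𝓕 ((Set.Ioc (-t) 0).indicator fun _ => (1 : ℂ)) σ
  have hK : ‖K‖ * japaneseBracket (2 * Real.pi * σ) ≤ t + 2 :=
    calc _ ≤ ‖K‖ * (1 + |2 * Real.pi * σ|) := by
          gcongr
          exact japaneseBracket_le_one_add_abs _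
      _ = ‖K‖ + ‖K‖ * |2 * Real.pi * σ| := by ring
      _ ≤ t + 2 := add_le_add (norm_fourier_indicator_Ioc_le ht σ)
          (norm_fourier_indicator_Ioc_mul_abs_le ht σ)
  rw [← ofReal_norm, bracketPow, Real.rpow_neg_one, ← ENNReal.ofReal_mul (by linarith)]
  exact ENNReal.ofReal_le_ofReal ((le_div_iff₀ (japaneseBracket_pos _)).2 hK)

theorem enorm_intervalIntegral_le (ht : 0 ≤ t) {g : ℝ → ℂ} (hg : Integrable g volume) :
    ‖∫ y in (0 : ℝ)..t, g y‖ₑ ≤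
      ENNReal.ofReal (t + 2) * ∫⁻ σ : ℝ, bracketPow (-1) (2 * Real.pi * σ) * ‖𝓕 g σ‖ₑ := by
  set χ : ℝ → ℂ := (Set.Ioc (-t) 0).indicator fun _ => (1 : ℂ)
  have hχ : Integrable χ volume := integrable_indicator_Ioc _ _
  have hzero : (χ ⋆[ContinuousLinearMap.mul ℂ ℂ] g) 0 = ∫ y in (0 : ℝ)..t, g y := by
    rw [convolution_indicator_Ioc ht, zero_add]
  rw [← hzero, ← lintegral_const_mul' _ _ ENNReal.ofReal_ne_top]
  refine (enorm_le_lintegral_enorm_fourier (hχ.integrable_convolution _ hg)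
    (continuous_convolution_indicator_Ioc ht hg).continuousAt).trans (lintegral_mono fun σ => ?_)
  rw [Real.fourier_mul_convolution_eq hχ hg, enorm_mul, ← mul_assoc]
  gcongr
  exact enorm_fourier_indicator_Ioc_le ht σ

end TimeIntegral

section Profile

theorem continuous_freeSymbol (ξ : ℝ) : Continuous fun t => freeSymbol t ξ := by
  unfold freeSymbol
  fun_prop

theorem norm_freeSymbol (t ξ : ℝ) : ‖freeSymbol t ξ‖ = 1 := by
  rw [freeSymbol, Complex.norm_exp_ofReal_mul_I]

theorem freeSymbol_sub (t t' ξ : ℝ) :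
    freeSymbol (t - t') ξ = freeSymbol t ξ * freeSymbol (-t') ξ := by
  rw [freeSymbol, freeSymbol, freeSymbol, ← Complex.exp_add]
  congr 1
  push_cast
  ring

/-- The spatial Fourier transform of `F(t)` in the interaction picture, `e^{itk²} F̂(t)(ξ)`. -/
def profile (F : SpaceTime → ℂ) (ξ t : ℝ) : ℂ :=
  freeSymbol (-t) ξ * (𝓕 (fun x : ℝ => F (WithLp.toLp 2 (t, x))) : ℝ → ℂ) ξ

/-- The point of frequency space with spatial frequency `ξ` at which the modulation `ω + k²` is
`2πσ`; the time Fourier transform of the profile of `F` at `σ` is `𝓕 F` at this point. -/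
def profilePoint (σ ξ : ℝ) : SpaceTime := WithLp.toLp 2 (σ - 2 * Real.pi * ξ ^ 2, ξ)

@[fun_prop]
theorem measurable_profilePoint (ξ : ℝ) : Measurable fun σ => profilePoint σ ξ := by
  unfold profilePoint
  fun_prop

theorem continuous_profilePoint (σ : ℝ) : Continuous (profilePoint σ) := by
  unfold profilePoint
  fun_prop

theorem enorm_bourgainWeight_profilePoint (s b σ ξ : ℝ) :
    ‖(bourgainWeight s b (profilePoint σ ξ) : ℂ)‖ₑ =
      bracketPow s (2 * Real.pi * ξ) * bracketPow b (2 * Real.pi * σ) := by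
  rw [enorm_bourgainWeight, profilePoint, spatialFreq_toLp, modulation_toLp]
  congr 2
  ring

theorem lintegral_profilePoint {φ : SpaceTime → ℝ≥0∞} (hφ : Measurable φ) :
    ∫⁻ ξ : ℝ, ∫⁻ σ : ℝ, φ (profilePoint σ ξ) = ∫⁻ ζ, φ ζ := by
  rw [lintegral_spaceTime hφ]
  exact lintegral_congr fun ξ =>
    lintegral_sub_right_eq_self (fun τ => φ (WithLp.toLp 2 (τ, ξ))) (2 * Real.pi * ξ ^ 2)

theorem smul_profile (F : SpaceTime → ℂ) (σ ξ t : ℝ) :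
    Real.fourierChar (-(t * σ)) • profile F ξ t =
      ∫ x : ℝ, Real.fourierChar (-inner ℝ (WithLp.toLp 2 (t, x)) (profilePoint σ ξ)) •
        F (WithLp.toLp 2 (t, x)) := by
  rw [profile, Real.fourier_real_eq, Circle.smul_def, smul_eq_mul, ← mul_assoc,
    ← integral_const_mul]
  refine integral_congr_ae (Eventually.of_forall fun x => ?_)
  simp only [Circle.smul_def, smul_eq_mul, ← mul_assoc]
  congr 1
  rw [Real.fourierChar_apply, Real.fourierChar_apply, Real.fourierChar_apply, freeSymbol,
    ← Complex.exp_add, ← Complex.exp_add, WithLp.prod_inner_apply]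
  congr 1
  simp [profilePoint]
  ring

variable {F : SpaceTime → ℂ}

theorem integrable_fourierChar_smul_toLp (hF : Integrable F volume) (w : SpaceTime) :
    Integrable (fun z : ℝ × ℝ => Real.fourierChar (-inner ℝ (WithLp.toLp 2 z) w) •
      F (WithLp.toLp 2 z)) (volume.prod volume) :=
  (WithLp.volume_preserving_toLp ℝ ℝ).integrable_comp_of_integrable
    ((Real.fourierIntegral_convergent_iff w).2 hF)

theorem integrable_profile (hF : Integrable F volume) (ξ : ℝ) :
    Integrable (profile F ξ) volume := by
  refine (integrable_fourierChar_smul_toLp hF (profilePoint 0 ξ)).integral_prod_left.congr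
    (Eventually.of_forall fun t => ?_)
  beta_reduce
  rw [← smul_profile, mul_zero, neg_zero, AddChar.map_zero_eq_one, one_smul]

theorem fourier_profile (hF : Integrable F volume) (ξ σ : ℝ) :
    𝓕 (profile F ξ) σ = 𝓕 F (profilePoint σ ξ) := by
  rw [Real.fourier_real_eq]
  simp only [smul_profile]
  rw [← integral_prod _ (integrable_fourierChar_smul_toLp hF _), Real.fourier_eq,
    ← Measure.volume_eq_prod]
  exact (WithLp.volume_preserving_toLp ℝ ℝ).integral_comp
    (MeasurableEquiv.toLp 2 (ℝ × ℝ)).measurableEmbedding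
    (fun z => Real.fourierChar (-inner ℝ z (profilePoint σ ξ)) • F z)

theorem profile_indicator (F : SpaceTime → ℂ) (S : Set ℝ) (ξ : ℝ) :
    profile ((WithLp.fst ⁻¹' S).indicator F) ξ = S.indicator (profile F ξ) := by
  funext t
  by_cases ht : t ∈ S
  · simp [profile, Set.indicator, ht]
  · simp [profile, Set.indicator, ht, Real.fourier_eq]

theorem intervalIntegral_profile (hF : Integrable F volume) {t : ℝ} (ht : 0 ≤ t) (ξ : ℝ) :
    ∫ t' in (0 : ℝ)..t, profile F ξ t' =
      𝓕 ((WithLp.fst ⁻¹' Set.Ioc 0 t).indicator F) (profilePoint 0 ξ) := by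
  have hS : MeasurableSet (WithLp.fst ⁻¹' Set.Ioc 0 t : Set SpaceTime) :=
    measurableSet_Ioc.preimage (by fun_prop)
  rw [← fourier_profile (hF.indicator hS), profile_indicator, Real.fourier_real_eq,
    intervalIntegral.integral_of_le ht, ← integral_indicator measurableSet_Ioc]
  simp

/-- The integral `∫ ⟨ω⟩⁻¹ |𝓕 F|` over the modulation `ω = 2πσ` at the spatial frequency `ξ`, which
controls the primitives of the profile. -/
def profileBound (F : SpaceTime → ℂ) (ξ : ℝ) : ℝ≥0∞ :=
  ∫⁻ σ : ℝ, bracketPow (-1) (2 * Real.pi * σ) * ‖𝓕 F (profilePoint σ ξ)‖ₑ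

theorem enorm_intervalIntegral_profile_le (hF : Integrable F volume) {t T : ℝ}
    (ht : t ∈ Set.Icc 0 T) (ξ : ℝ) :
    ‖∫ t' in (0 : ℝ)..t, profile F ξ t'‖ₑ ≤ ENNReal.ofReal (T + 2) * profileBound F ξ := by
  refine (enorm_intervalIntegral_le ht.1 (integrable_profile hF ξ)).trans ?_
  simp only [fourier_profile hF, profileBound]
  gcongr
  exact ht.2

theorem sq_lintegral_bracketPow_neg_one_mul_le (δ : ℝ) {g : ℝ → ℝ≥0∞} (hg : Measurable g) :
    (∫⁻ σ : ℝ, bracketPow (-1) (2 * Real.pi * σ) * g σ) ^ 2 ≤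
      (∫⁻ y, bracketPow (-(1 + 2 * δ)) y) *
        ∫⁻ σ : ℝ, (bracketPow (-1 / 2 + δ) (2 * Real.pi * σ) * g σ) ^ 2 := by
  have hsplit : ∀ y, bracketPow (-1) y = bracketPow (-(1 / 2 + δ)) y * bracketPow (-1 / 2 + δ) y :=
    fun y => by
      rw [bracketPow_mul]
      congr 1
      ring
  simp only [hsplit, mul_assoc (bracketPow (-(1 / 2 + δ)) _)]
  refine (sq_lintegral_mul_le (by fun_prop) (by fun_prop)).trans (mul_le_mul_left ?_ _)
  simp only [bracketPow_sq, show 2 * -(1 / 2 + δ) = -(1 + 2 * δ) by ring]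
  exact lintegral_comp_two_pi_mul_le (g := bracketPow (-(1 + 2 * δ))) (by fun_prop)

theorem lintegral_sq_profileBound_le (s : ℝ) {δ : ℝ} (hδ : 0 < δ) :
    ∃ C : ℝ≥0, ∀ F : SpaceTime → ℂ, Integrable F volume →
      ∫⁻ ξ : ℝ, (bracketPow s (2 * Real.pi * ξ) * profileBound F ξ) ^ 2 ≤
        C * eLpNorm (fun ζ => (bourgainWeight s (-1 / 2 + δ) ζ : ℂ) * 𝓕 F ζ) 2 volume ^ 2 := by
  set I := ∫⁻ y, bracketPow (-(1 + 2 * δ)) y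
  have hI : I ≠ ∞ := (lintegral_bracketPow_lt_top (by linarith)).ne
  refine ⟨I.toNNReal, fun F hF => ?_⟩
  have hm : Measurable fun ζ => ‖𝓕 F ζ‖ₑ := (continuous_fourier_of_integrable hF).measurable.enorm
  have hmξ : ∀ ξ, Measurable fun σ => ‖𝓕 F (profilePoint σ ξ)‖ₑ := fun ξ =>
    hm.comp (measurable_profilePoint ξ)
  have hmw := measurable_enorm_bourgainWeight s (-1 / 2 + δ)
  simp only [eLpNorm_two_sq, enorm_mul]
  rw [ENNReal.coe_toNNReal hI, ← lintegral_profilePoint (by fun_prop),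
    ← lintegral_const_mul' _ _ hI]
  refine lintegral_mono fun ξ => ?_
  simp only [enorm_bourgainWeight_profilePoint, mul_assoc (bracketPow s _),
    mul_pow (bracketPow s _)]
  have hmξ' := hmξ ξ
  rw [lintegral_const_mul _ (by fun_prop), mul_left_comm]
  gcongr
  exact sq_lintegral_bracketPow_neg_one_mul_le δ (hmξ ξ)

end Profile

section Duhamel

theorem sobolevNorm_sq (s : ℝ) (f : Lp ℂ 2 (volume : Measure ℝ)) :
    sobolevNorm s f ^ 2 = ∫⁻ ξ : ℝ, (bracketPow s (2 * Real.pi * ξ) *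
      ‖(𝓕 f : Lp ℂ 2 (volume : Measure ℝ)) ξ‖ₑ) ^ 2 := by
  rw [sobolevNorm, weightedFourierNorm_Lp_two, eLpNorm_two_sq]
  simp only [enorm_mul, bracketPow_eq_enorm]

theorem fourier_freeEvolution (t : ℝ) (f : Lp ℂ 2 (volume : Measure ℝ)) :
    (𝓕 (freeEvolution t f) : Lp ℂ 2 (volume : Measure ℝ)) =ᵐ[volume]
      fun ξ => freeSymbol t ξ * (𝓕 f : Lp ℂ 2 (volume : Measure ℝ)) ξ := by
  rw [freeEvolution, fourier_fourierInv_eq]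
  exact MemLp.coeFn_toLp _

theorem fourier_Lp_two_sub (f g : Lp ℂ 2 (volume : Measure ℝ)) :
    (𝓕 (f - g) : Lp ℂ 2 (volume : Measure ℝ)) =ᵐ[volume]
      fun ξ => (𝓕 f : Lp ℂ 2 (volume : Measure ℝ)) ξ - (𝓕 g : Lp ℂ 2 (volume : Measure ℝ)) ξ := by
  have h : 𝓕 (f - g) = (𝓕 f - 𝓕 g : Lp ℂ 2 (volume : Measure ℝ)) := by
    rw [sub_eq_add_neg, FourierTransform.fourier_add, FourierTransform.fourier_neg,
      ← sub_eq_add_neg]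
  rw [h]
  exact Lp.coeFn_sub _ _

/-- The spatial Fourier transform of the Duhamel term `∫₀ᵗ e^{i(t-t')∂_x²} F(t') dt'`. -/
def duhamelFourier (F : SpaceTime → ℂ) (t ξ : ℝ) : ℂ :=
  freeSymbol t ξ * ∫ t' in (0 : ℝ)..t, profile F ξ t'

theorem enorm_duhamelFourier_le {F : SpaceTime → ℂ} (hF : Integrable F volume) {t T : ℝ}
    (ht : t ∈ Set.Icc 0 T) (ξ : ℝ) :
    ‖duhamelFourier F t ξ‖ₑ ≤ ENNReal.ofReal (T + 2) * profileBound F ξ := by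
  rw [duhamelFourier, enorm_mul, ← ofReal_norm (freeSymbol t ξ), norm_freeSymbol,
    ENNReal.ofReal_one, one_mul]
  exact enorm_intervalIntegral_profile_le hF ht ξ

theorem continuous_duhamelFourier_right {F : SpaceTime → ℂ} (hF : Integrable F volume) {t : ℝ}
    (ht : 0 ≤ t) : Continuous (duhamelFourier F t) := by
  have hS : MeasurableSet (WithLp.fst ⁻¹' Set.Ioc 0 t : Set SpaceTime) :=
    measurableSet_Ioc.preimage (by fun_prop)
  have hfree : Continuous (freeSymbol t) := by
    unfold freeSymbol
    fun_prop
  have hprofile : Continuous fun ξ => ∫ t' in (0 : ℝ)..t, profile F ξ t' := by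
    simp only [intervalIntegral_profile hF ht]
    exact (continuous_fourier_of_integrable (hF.indicator hS)).comp (continuous_profilePoint 0)
  exact hfree.mul hprofile

theorem continuous_duhamelFourier_left {F : SpaceTime → ℂ} (hF : Integrable F volume) (ξ : ℝ) :
    Continuous fun t => duhamelFourier F t ξ :=
  (continuous_freeSymbol ξ).mul (intervalIntegral.continuous_primitive
    (fun _ _ => (integrable_profile hF ξ).intervalIntegrable) 0)

variable {μ T t : ℝ} {u₀ : Lp ℂ 2 (volume : Measure ℝ)} {u : ℝ → Lp ℂ 2 (volume : Measure ℝ)}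
  {v : Lp ℂ 2 (volume : Measure SpaceTime)}

theorem AgreesOn.intervalIntegral_eq_duhamelFourier (huv : AgreesOn T u v)
    (ht : t ∈ Set.Icc 0 T) (ξ : ℝ) :
    ∫ t' in (0 : ℝ)..t, freeSymbol (t - t') ξ * (𝓕 (fun x => quintic (u t' x)) : ℝ → ℂ) ξ =
      duhamelFourier (fun z => quintic (v z)) t ξ := by
  rw [duhamelFourier, ← intervalIntegral.integral_const_mul]
  refine intervalIntegral.integral_congr_ae ?_
  filter_upwards [huv] with t' hagree ht'
  rw [Set.uIoc_of_le ht.1] at ht'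
  have hae : (fun x => quintic (u t' x)) =ᵐ[volume]
      fun x => quintic (v (WithLp.toLp 2 (t', x))) := by
    filter_upwards [hagree ⟨ht'.1.le, ht'.2.trans ht.2⟩] with x hx
    rw [hx]
  rw [freeSymbol_sub, profile, Real.fourier_congr_ae hae, mul_assoc]

theorem IsMildSolution.fourier_sub_freeEvolution (hu : IsMildSolution μ T u₀ u)
    (huv : AgreesOn T u v) (ht : t ∈ Set.Icc 0 T) :
    (𝓕 (u t - freeEvolution t u₀) : Lp ℂ 2 (volume : Measure ℝ)) =ᵐ[volume] fun ξ =>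
      -(Complex.I * μ) * duhamelFourier (fun z => quintic (v z)) t ξ := by
  filter_upwards [fourier_Lp_two_sub (u t) (freeEvolution t u₀), fourier_freeEvolution t u₀,
    hu.duhamel t ht] with ξ hsub hfree hduhamel
  rw [hsub, hfree, hduhamel, huv.intervalIntegral_eq_duhamelFourier ht]
  ring

end Duhamel

section Smoothing

variable {F : SpaceTime → ℂ} {r T t₀ : ℝ}

theorem tendsto_lintegral_sq_duhamelFourier_sub (hF : Integrable F volume)
    (hfin : ∫⁻ ξ : ℝ, (bracketPow r (2 * Real.pi * ξ) * profileBound F ξ) ^ 2 ≠ ∞)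
    (ht₀ : t₀ ∈ Set.Icc 0 T) :
    Tendsto (fun t => ∫⁻ ξ : ℝ, (bracketPow r (2 * Real.pi * ξ) *
        ‖duhamelFourier F t ξ - duhamelFourier F t₀ ξ‖ₑ) ^ 2)
      (𝓝[Set.Icc 0 T] t₀) (𝓝 0) := by
  rw [← lintegral_zero (α := ℝ) (μ := volume)]
  refine tendsto_lintegral_filter_of_dominated_convergence
    (fun ξ => (2 * ENNReal.ofReal (T + 2)) ^ 2 *
      (bracketPow r (2 * Real.pi * ξ) * profileBound F ξ) ^ 2) ?_ ?_ ?_ ?_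
  · filter_upwards [self_mem_nhdsWithin] with t ht
    have hm : ∀ t ∈ Set.Icc 0 T, Measurable (duhamelFourier F t) := fun t ht =>
      (continuous_duhamelFourier_right hF ht.1).measurable
    exact (Measurable.mul (by fun_prop) ((hm t ht).sub (hm t₀ ht₀)).enorm).pow_const 2
  · filter_upwards [self_mem_nhdsWithin] with t ht
    refine Eventually.of_forall fun ξ => ?_
    rw [← mul_pow, mul_left_comm]
    gcongr
    rw [mul_assoc, two_mul]
    exact enorm_sub_le.trans
      (add_le_add (enorm_duhamelFourier_le hF ht ξ) (enorm_duhamelFourier_le hF ht₀ ξ))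
  · rw [lintegral_const_mul' _ _ (by finiteness)]
    finiteness
  · refine Eventually.of_forall fun ξ => ?_
    have hsub : Tendsto (fun t => ‖duhamelFourier F t ξ - duhamelFourier F t₀ ξ‖ₑ)
        (𝓝[Set.Icc 0 T] t₀) (𝓝 0) :=
      (((continuous_duhamelFourier_left hF ξ).sub continuous_const).enorm.tendsto' t₀ 0
        (by simp)).mono_left nhdsWithin_le_nhds
    simpa using ENNReal.Tendsto.pow (n := 2) (ENNReal.Tendsto.const_mul
      (a := bracketPow r (2 * Real.pi * ξ)) hsub (Or.inr ENNReal.ofReal_ne_top))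

variable {μ : ℝ} {u₀ : Lp ℂ 2 (volume : Measure ℝ)} {u : ℝ → Lp ℂ 2 (volume : Measure ℝ)}
  {v : Lp ℂ 2 (volume : Measure SpaceTime)}

theorem enorm_neg_I_mul_ofReal_mul (μ : ℝ) (z : ℂ) :
    ‖-(Complex.I * μ) * z‖ₑ = ‖μ‖ₑ * ‖z‖ₑ := by
  rw [enorm_mul, ← ofReal_norm, norm_neg, norm_mul, Complex.norm_I, one_mul, Complex.norm_real,
    ofReal_norm]

theorem IsMildSolution.sobolevNorm_sub_freeEvolution_le (hu : IsMildSolution μ T u₀ u)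
    (huv : AgreesOn T u v) (hv : Integrable (fun z => quintic (v z)) volume) {B : ℝ≥0∞}
    (hB : ∫⁻ ξ : ℝ, (bracketPow r (2 * Real.pi * ξ) *
      profileBound (fun z => quintic (v z)) ξ) ^ 2 ≤ B ^ 2) {t : ℝ} (ht : t ∈ Set.Icc 0 T) :
    sobolevNorm r (u t - freeEvolution t u₀ : Lp ℂ 2 (volume : Measure ℝ)) ≤
      ‖μ‖ₑ * ENNReal.ofReal (T + 2) * B := by
  rw [← ENNReal.pow_le_pow_left_iff two_ne_zero, sobolevNorm_sq, mul_pow]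
  refine le_trans ?_ (mul_le_mul_right hB _)
  rw [← lintegral_const_mul' _ _ (by finiteness)]
  refine lintegral_mono_ae ?_
  filter_upwards [hu.fourier_sub_freeEvolution huv ht] with ξ hξ
  rw [hξ, enorm_neg_I_mul_ofReal_mul, ← mul_pow, mul_left_comm, mul_assoc ‖μ‖ₑ,
    mul_left_comm (ENNReal.ofReal _)]
  gcongr
  exact enorm_duhamelFourier_le hv ht ξ

theorem IsMildSolution.tendsto_sobolevNorm_sub_freeEvolution (hu : IsMildSolution μ T u₀ u)
    (huv : AgreesOn T u v) (hv : Integrable (fun z => quintic (v z)) volume)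
    (hfin : ∫⁻ ξ : ℝ, (bracketPow r (2 * Real.pi * ξ) *
      profileBound (fun z => quintic (v z)) ξ) ^ 2 ≠ ∞) (ht₀ : t₀ ∈ Set.Icc 0 T) :
    Tendsto (fun t => sobolevNorm r
        ((u t - freeEvolution t u₀) - (u t₀ - freeEvolution t₀ u₀) : Lp ℂ 2 (volume : Measure ℝ)))
      (𝓝[Set.Icc 0 T] t₀) (𝓝 0) := by
  have hsq : Tendsto (fun t => sobolevNorm r ((u t - freeEvolution t u₀) -
      (u t₀ - freeEvolution t₀ u₀) : Lp ℂ 2 (volume : Measure ℝ)) ^ 2)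
      (𝓝[Set.Icc 0 T] t₀) (𝓝 0) := by
    have hlim := ENNReal.Tendsto.const_mul (a := ‖μ‖ₑ ^ 2)
      (tendsto_lintegral_sq_duhamelFourier_sub hv hfin ht₀) (Or.inr (by finiteness))
    rw [mul_zero] at hlim
    refine hlim.congr' ?_
    filter_upwards [self_mem_nhdsWithin] with t ht
    rw [sobolevNorm_sq, ← lintegral_const_mul' _ _ (by finiteness)]
    refine lintegral_congr_ae ?_
    filter_upwards [fourier_Lp_two_sub (u t - freeEvolution t u₀) (u t₀ - freeEvolution t₀ u₀),
      hu.fourier_sub_freeEvolution huv ht, hu.fourier_sub_freeEvolution huv ht₀]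
      with ξ hsub hξ hξ₀
    rw [hsub, hξ, hξ₀, ← mul_sub, enorm_neg_I_mul_ofReal_mul, mul_left_comm, mul_pow ‖μ‖ₑ]
  have hroot := (ENNReal.continuous_rpow_const (y := 1 / 2)).tendsto 0 |>.comp hsq
  rw [ENNReal.zero_rpow_of_pos (by norm_num)] at hroot
  refine hroot.congr fun t => ?_
  rw [Function.comp_apply, ← ENNReal.rpow_natCast, ← ENNReal.rpow_mul]
  norm_num

variable {s a : ℝ}

theorem lintegral_sq_profileBound_quintic_le (hs : 1 / 3 < s)
    (ha : a < min (3 * s - 1) (1 / 2)) {ε : ℝ} (hε : 0 < ε) :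
    ∃ C : ℝ≥0, ∀ v : Lp ℂ 2 (volume : Measure SpaceTime), bourgainNorm s (1 / 2 + ε) v ≠ ∞ →
      ∫⁻ ξ : ℝ, (bracketPow (s + a) (2 * Real.pi * ξ) *
        profileBound (fun z => quintic (v z)) ξ) ^ 2 ≤
        (C * bourgainNorm s (1 / 2 + ε) v ^ 5) ^ 2 := by
  obtain ⟨δ₀, hδ₀, h⟩ := exists_eLpNorm_bourgainWeight_mul_fourier_quintic_le hs ha
  obtain ⟨C₁, hC₁⟩ := h (δ₀ / 2) (by linarith) (by linarith) ε hε
  obtain ⟨C₂, hC₂⟩ := lintegral_sq_profileBound_le (s + a) (half_pos hδ₀)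
  refine ⟨NNReal.sqrt C₂ * C₁, fun v hv => ?_⟩
  have hint := (integrable_quintic_and_enorm_fourier_le_of_bourgainNorm (by linarith)
    (by linarith) hv).1
  calc _ ≤ C₂ * (C₁ * bourgainNorm s (1 / 2 + ε) v ^ 5) ^ 2 :=
        (hC₂ _ hint).trans (by gcongr; exact hC₁ v hv)
    _ = _ := by
        rw [ENNReal.coe_mul, mul_assoc, mul_pow (NNReal.sqrt C₂ : ℝ≥0∞), ← ENNReal.coe_pow,
          NNReal.sq_sqrt]

end Smoothing

end QuinticNLS

end

section MainTheorem

open QuinticNLS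

theorem mainTheorem7_general (s a : ℝ) (hs : 1 / 3 < s) (ha : a < min (3 * s - 1) (1 / 2)) :
    (∃ δ₀ : ℝ, 0 < δ₀ ∧ ∀ δ : ℝ, 0 < δ → δ < δ₀ → ∀ ε : ℝ, 0 < ε → ∃ C : ℝ≥0,
      ∀ u : Lp ℂ 2 (volume : Measure SpaceTime), bourgainNorm s (1 / 2 + ε) u ≠ ∞ →
        ∃ hu : MemLp (fun z => quintic (u z)) 1 volume,
          bourgainNorm (s + a) (-1 / 2 + δ) (hu.toLp _) ≤
            C * bourgainNorm s (1 / 2 + ε) u ^ 5) ∧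
    (∀ ε : ℝ, 0 < ε → ∀ T : ℝ, ∃ C : ℝ≥0, ∀ (μ : ℝ) (u₀ : Lp ℂ 2 (volume : Measure ℝ))
      (u : ℝ → Lp ℂ 2 (volume : Measure ℝ)) (v : Lp ℂ 2 (volume : Measure SpaceTime)),
        bourgainNorm s (1 / 2 + ε) v ≠ ∞ → AgreesOn T u v → IsMildSolution μ T u₀ u →
        (∀ t ∈ Set.Icc 0 T,
          sobolevNorm (s + a) (u t - freeEvolution t u₀ : Lp ℂ 2 (volume : Measure ℝ)) ≤
            ‖μ‖ₑ * (C * bourgainNorm s (1 / 2 + ε) v ^ 5)) ∧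
        ∀ t₀ ∈ Set.Icc 0 T,
          Tendsto (fun t => sobolevNorm (s + a)
              ((u t - freeEvolution t u₀) - (u t₀ - freeEvolution t₀ u₀) :
                Lp ℂ 2 (volume : Measure ℝ)))
            (𝓝[Set.Icc 0 T] t₀) (𝓝 0)) := by
  refine ⟨bourgainNorm_quintic_le hs ha, fun ε hε T => ?_⟩
  obtain ⟨C, hC⟩ := lintegral_sq_profileBound_quintic_le hs ha hε
  refine ⟨(T + 2).toNNReal * C, fun μ u₀ u v hv huv hu => ?_⟩
  have hint := (integrable_quintic_and_enorm_fourier_le_of_bourgainNorm (by linarith)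
    (by linarith) hv).1
  refine ⟨fun t ht => ?_, fun t₀ ht₀ =>
    hu.tendsto_sobolevNorm_sub_freeEvolution huv hint
      ((hC v hv).trans_lt (by finiteness)).ne ht₀⟩
  simpa only [ENNReal.coe_mul, mul_assoc, ENNReal.ofReal] using
    hu.sobolevNorm_sub_freeEvolution_le huv hint (hC v hv) ht

end MainTheorem

theorem mainTheorem7 (s a : ℝ) (hs : 1 / 3 < s) (ha : a < min (3 * s - 1) (1 / 2)) :
    -- the multilinear estimate
    (∃ δ₀ : ℝ, 0 < δ₀ ∧ ∀ δ : ℝ, 0 < δ → δ < δ₀ → ∀ ε : ℝ, 0 < ε → ∃ C : ℝ≥0,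
      ∀ u : Lp ℂ 2 (volume : Measure QuinticNLS.SpaceTime),
        QuinticNLS.bourgainNorm s (1 / 2 + ε) u ≠ ∞ →
        ∃ hu : MemLp (fun z => QuinticNLS.quintic (u z)) 1 volume,
          QuinticNLS.bourgainNorm (s + a) (-1 / 2 + δ) (hu.toLp _) ≤
            C * QuinticNLS.bourgainNorm s (1 / 2 + ε) u ^ 5) ∧
    -- the nonlinear smoothing
    (∀ ε : ℝ, 0 < ε → ∀ T : ℝ, 0 < T → ∃ C : ℝ≥0, ∀ μ : ℝ, (μ = 1 ∨ μ = -1) →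
      ∀ (u₀ : Lp ℂ 2 (volume : Measure ℝ)) (u : ℝ → Lp ℂ 2 (volume : Measure ℝ))
        (v : Lp ℂ 2 (volume : Measure QuinticNLS.SpaceTime)),
        QuinticNLS.sobolevNorm s u₀ ≠ ∞ →
        QuinticNLS.bourgainNorm s (1 / 2 + ε) v ≠ ∞ →
        QuinticNLS.AgreesOn T u v →
        QuinticNLS.IsMildSolution μ T u₀ u →
        (∀ t ∈ Set.Icc 0 T,
          QuinticNLS.sobolevNorm (s + a)
              (u t - QuinticNLS.freeEvolution t u₀ : Lp ℂ 2 (volume : Measure ℝ)) ≤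
            C * QuinticNLS.bourgainNorm s (1 / 2 + ε) v ^ 5) ∧
        ∀ t₀ ∈ Set.Icc 0 T,
          Tendsto (fun t => QuinticNLS.sobolevNorm (s + a)
              ((u t - QuinticNLS.freeEvolution t u₀) - (u t₀ - QuinticNLS.freeEvolution t₀ u₀) :
                Lp ℂ 2 (volume : Measure ℝ)))
            (𝓝[Set.Icc 0 T] t₀) (𝓝 0)) := by
  obtain ⟨hquintic, hsmooth⟩ := mainTheorem7_general s a hs ha
  refine ⟨hquintic, fun ε hε T _ => (hsmooth ε hε T).imp fun C hC μ hμ u₀ u v _ hv huv hu => ?_⟩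
  have hμ' : ‖μ‖ₑ = 1 := by rcases hμ with rfl | rfl <;> simp
  simpa only [hμ', one_mul] using hC μ u₀ u v hv huv hu
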